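/- Let $\alpha>1/2$, $\beta\in\mathbb R$, $c>0$ and $1/2<\delta<\alpha$. Then there are constants $C_1,C_2>0$, depending only on $\alpha,\beta,c$ and $\delta$ (hence only on $\alpha,\beta,c$ once $\delta$ is fixed as a function of $\alpha$), such that the following holds. Let $(D,\mathcal A,\mu)$ be a measure space for which $L_2=L_2(D,\mathcal A,\mu)$ (complex-valued) is infinite-dimensional, let $F_0$ be a countable set of square-integrable functions $D\to\mathbb C$, and let $$a_n(F_0,L_2)=\inf_{\operatorname{rank}(T)\le n}\ \sup_{f\in F_0}\|f-Tf\|_{L_2}$$ (infimum over linear $T\colon L_2\to L_2$) satisfy $a_n(F_0,L_2)\le c\,n^{-\alpha}\log^\beta(n+1)$ for all $n\ge1$. (i) There is an orthonormal system $(b_k)_{k\ge1}$ in $L_2$ such that, with $P_n$ the orthogonal projection onto $V_n=\operatorname{span}\{b_1,\dots,b_n\}$, $$\sup_{f\in F_0}\|f-P_nf\|_{L_2}\le 2\,a_{\lceil n/4\rceil}(F_0,L_2)\qquad\text{for all } n\ge1.\tag{$*$}$$ (ii) Let $(b_k)$ be any orthonormal system in $L_2$ satisfying $(*)$, represented by arbitrary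 functions $b_k\colon D\to\mathbb C$ from the equivalence classes, and let $n\ge1$. Then $$\varrho(x)=\frac12\Big(\frac1n\sum_{k\le n}|b_k(x)|^2+\frac1{Z_n}\sum_{k>n}k^{-2\delta}|b_k(x)|^2\Big),\qquad Z_n=\sum_{k>n}k^{-2\delta},$$ is a probability density with respect to $\mu$. Let $m=\lceil C_1 n\log(n+1)\rceil$ and let $x_1,\dots,x_m$ be i.i.d. random points in $D$ with $\mu$-density $\varrho$. Consider the weighted least squares estimator $$A_{m,n}(f)=\sum_{k=1}^n (G^+Nf)_k\,b_k,\qquad G=\big(\varrho(x_i)^{-1/2}b_k(x_i)\big)_{i\le m,\,k\le n},\qquad Nf=\big(\varrho(x_i)^{-1/2}f(x_i)\big)_{i\le m},$$ where $G^+$ is the Moore--Penrose inverse (so that $A_{m,n}(f)$ minimizes $\sum_{i=1}^m|g(x_i)-f(x_i)|^2/\varrho(x_i)$ over $g\in V_n$). Then, with probability at least $1-5/n^2$, $$\sup_{f\in F_0}\|f-A_{m,n}(f)\|_{L_2}\le C_2\,n^{-\alpha}\log^\beta(n+1).$$ -/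

import Mathlib

open MeasureTheory ProbabilityTheory
open scoped ENNReal Matrix

noncomputable section

/-! ### Moore-Penrose inverse -/

/-- The four Penrose equations: `X` is the Moore-Penrose inverse of `G`. -/
structure IsMoorePenrose {m n : ℕ} (G : Matrix (Fin m) (Fin n) ℂ)
    (X : Matrix (Fin n) (Fin m) ℂ) : Prop where
  mul_mul_self : G * X * G = G
  self_mul_mul : X * G * X = X
  left_hermitian : (G * X).IsHermitian
  right_hermitian : (X * G).IsHermitian

open scoped ComplexOrder in
/-- Every complex matrix has a Moore-Penrose inverse. -/
theorem exists_isMoorePenrose {m n : ℕ} (G : Matrix (Fin m) (Fin n) ℂ) :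
    ∃ X, IsMoorePenrose G X := by
  obtain ⟨B, hB, hABA, hBAB, hcomm⟩ : ∃ B : Matrix (Fin n) (Fin n) ℂ, Bᴴ = B ∧
      (Gᴴ * G) * B * (Gᴴ * G) = Gᴴ * G ∧ B * (Gᴴ * G) * B = B ∧
      (Gᴴ * G) * B = B * (Gᴴ * G) := by
    have hA : (Gᴴ * G).IsHermitian := Matrix.isHermitian_conjTranspose_mul_self G
    obtain ⟨U, d, hU, hspec⟩ : ∃ (U : Matrix (Fin n) (Fin n) ℂ) (d : Fin n → ℝ),
        Uᴴ * U = 1 ∧ Gᴴ * G = U * Matrix.diagonal (fun i => (d i : ℂ)) * Uᴴ := by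
      refine ⟨hA.eigenvectorUnitary, hA.eigenvalues, ?_, ?_⟩
      · exact Unitary.coe_star_mul_self hA.eigenvectorUnitary
      · exact hA.spectral_theorem
    have key : ∀ P Q : Matrix (Fin n) (Fin n) ℂ,
        (U * P * Uᴴ) * (U * Q * Uᴴ) = U * (P * Q) * Uᴴ := by
      intro P Q
      calc (U * P * Uᴴ) * (U * Q * Uᴴ) = U * P * (Uᴴ * U) * Q * Uᴴ := by
            simp only [Matrix.mul_assoc]
        _ = U * (P * Q) * Uᴴ := by rw [hU]; simp only [Matrix.mul_assoc, Matrix.one_mul]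
    refine ⟨U * Matrix.diagonal (fun i => ((d i : ℂ))⁻¹) * Uᴴ, ?_, ?_, ?_, ?_⟩
    · simp only [Matrix.conjTranspose_mul, Matrix.conjTranspose_conjTranspose,
        Matrix.diagonal_conjTranspose, Matrix.mul_assoc]
      congr 3
      ext i
      simp
    · rw [hspec, key, key, Matrix.diagonal_mul_diagonal, Matrix.diagonal_mul_diagonal]
      congr 4
      ext i
      by_cases h : (d i : ℂ) = 0 <;> simp [h]
    · rw [hspec, key, key, Matrix.diagonal_mul_diagonal, Matrix.diagonal_mul_diagonal]
      congr 4
      ext i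
      by_cases h : (d i : ℂ) = 0 <;> simp [h]
    · rw [hspec, key, key, Matrix.diagonal_mul_diagonal, Matrix.diagonal_mul_diagonal]
      congr 4
      ext i
      exact mul_comm _ _
  have hGBA : G * B * (Gᴴ * G) = G := by
    have h0 : (G * B * (Gᴴ * G) - G)ᴴ * (G * B * (Gᴴ * G) - G) = 0 := by
      have e1 : (G * B * (Gᴴ * G) - G)ᴴ = Gᴴ * G * B * Gᴴ - Gᴴ := by
        simp [Matrix.conjTranspose_mul, hB, Matrix.mul_assoc]
      have e2 : (Gᴴ * G * B * Gᴴ - Gᴴ) * (G * B * (Gᴴ * G) - G)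
          = (Gᴴ * G) * B * (Gᴴ * G) * B * (Gᴴ * G) - (Gᴴ * G) * B * (Gᴴ * G)
            - ((Gᴴ * G) * B * (Gᴴ * G) - Gᴴ * G) := by
        simp only [Matrix.sub_mul, Matrix.mul_sub, Matrix.mul_assoc]
      rw [e1, e2, hABA, hABA]
      simp
    exact sub_eq_zero.1 (Matrix.conjTranspose_mul_self_eq_zero.1 h0)
  refine ⟨B * Gᴴ, ⟨?_, ?_, ?_, ?_⟩⟩
  · simpa only [Matrix.mul_assoc] using hGBA
  · calc B * Gᴴ * G * (B * Gᴴ) = B * (Gᴴ * G) * B * Gᴴ := by simp only [Matrix.mul_assoc]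
      _ = B * Gᴴ := by rw [hBAB]
  · simp [Matrix.IsHermitian, Matrix.conjTranspose_mul, hB, Matrix.mul_assoc]
  · have : B * Gᴴ * G = B * (Gᴴ * G) := Matrix.mul_assoc _ _ _
    rw [this, Matrix.IsHermitian, Matrix.conjTranspose_mul, hB, Matrix.conjTranspose_mul,
      Matrix.conjTranspose_conjTranspose, hcomm]

/-- The Moore-Penrose inverse `G⁺`; the Penrose equations determine it uniquely. -/
def moorePenrose {m n : ℕ} (G : Matrix (Fin m) (Fin n) ℂ) : Matrix (Fin n) (Fin m) ℂ :=
  Classical.choose (exists_isMoorePenrose G)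

theorem moorePenrose_spec {m n : ℕ} (G : Matrix (Fin m) (Fin n) ℂ) :
    IsMoorePenrose G (moorePenrose G) :=
  Classical.choose_spec (exists_isMoorePenrose G)

theorem IsMoorePenrose.unique {m n : ℕ} {G : Matrix (Fin m) (Fin n) ℂ}
    {X Y : Matrix (Fin n) (Fin m) ℂ} (hX : IsMoorePenrose G X) (hY : IsMoorePenrose G Y) :
    X = Y := by
  have h1 : G * X = G * Y := by
    calc G * X = (G * X)ᴴ := hX.left_hermitian.symm
      _ = ((G * Y) * (G * X))ᴴ := by rw [← Matrix.mul_assoc, hY.mul_mul_self]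
      _ = (G * X) * (G * Y) := by
        rw [Matrix.conjTranspose_mul, hX.left_hermitian, hY.left_hermitian]
      _ = G * Y := by rw [← Matrix.mul_assoc, hX.mul_mul_self]
  have h2 : X * G = Y * G := by
    calc X * G = (X * G)ᴴ := hX.right_hermitian.symm
      _ = ((X * G) * (Y * G))ᴴ := by
        rw [Matrix.mul_assoc, ← Matrix.mul_assoc G, hY.mul_mul_self]
      _ = (Y * G) * (X * G) := by
        rw [Matrix.conjTranspose_mul, hX.right_hermitian, hY.right_hermitian]
      _ = Y * G := by rw [Matrix.mul_assoc, ← Matrix.mul_assoc G, hX.mul_mul_self]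
  calc X = X * G * X := hX.self_mul_mul.symm
    _ = Y * (G * Y) := by rw [h2, Matrix.mul_assoc, h1]
    _ = Y := by rw [← Matrix.mul_assoc, hY.self_mul_mul]

/-! ### Approximation numbers and near-optimal orthonormal systems -/

section Hilbert

variable {H : Type*} [NormedAddCommGroup H] [InnerProductSpace ℂ H]

/-- `approxNumber S n = inf_{rank T ≤ n} sup_{f ∈ S} ‖f - T f‖`, the infimum over all linear
`T : H → H` of rank at most `n`; it may be `∞`. (The orthogonal projection onto the range of `T`
is at least as good as `T`, so restricting to bounded `T` gives the same number.) -/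
def approxNumber (S : Set H) (n : ℕ) : ℝ≥0∞ :=
  ⨅ (T : H →ₗ[ℂ] H) (_ : T.rank ≤ n), ⨆ f ∈ S, ‖f - T f‖ₑ

/-- The span `V_n` of the first `n` members of a sequence. -/
def firstSpan (b : ℕ → H) (n : ℕ) : Submodule ℂ H :=
  Submodule.span ℂ (Set.range fun k : Fin n => b k)

instance (b : ℕ → H) (n : ℕ) : FiniteDimensional ℂ (firstSpan b n) :=
  FiniteDimensional.span_of_finite ℂ (Set.finite_range _)

/-- `b` is orthonormal, and for each `n ≥ 1` the orthogonal projection onto the span of its first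
`n` members approximates `S` up to `2 a_{⌈n/4⌉}(S)`. -/
structure IsNearOptimalSystem (S : Set H) (b : ℕ → H) : Prop where
  orthonormal : Orthonormal ℂ b
  proj_error : ∀ n : ℕ, 1 ≤ n →
    ⨆ f ∈ S, ‖f - (firstSpan b n).starProjection f‖ₑ ≤ 2 * approxNumber S ⌈(n : ℝ) / 4⌉₊

end Hilbert

/-! ### Weighted least squares in `L₂` -/

section LeastSquares

variable {D : Type*} [MeasurableSpace D]

/-- The set of `L₂`-classes of the functions in `F`. -/
def l2Classes (μ : Measure D) (F : Set (D → ℂ)) : Set (Lp ℂ 2 μ) :=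
  {g | ∃ f ∈ F, g =ᵐ[μ] f}

/-- The sampling density; `b k` here is the `(k+1)`-st function of the system, so it carries the
weight `(k+1)^{-2δ}` for `k + 1 > n`. -/
def samplingDensity (b : ℕ → D → ℂ) (δ : ℝ) (n : ℕ) (y : D) : ℝ≥0∞ :=
  2⁻¹ * ((n : ℝ≥0∞)⁻¹ * ∑ k ∈ Finset.range n, ‖b k y‖ₑ ^ 2
    + (∑' k : ℕ, ENNReal.ofReal (((k + n + 1 : ℕ) : ℝ) ^ (-2 * δ)))⁻¹
      * ∑' k : ℕ, ENNReal.ofReal (((k + n + 1 : ℕ) : ℝ) ^ (-2 * δ)) * ‖b (k + n) y‖ₑ ^ 2)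

/-- `ϱ(y)^{-1/2}` as a complex number. -/
def invSqrtWeight (ϱ : D → ℝ≥0∞) (y : D) : ℂ :=
  (((ϱ y).toReal ^ (-(1 / 2) : ℝ) : ℝ) : ℂ)

/-- The matrix `G = (ϱ(x_i)^{-1/2} b_k(x_i))_{i ≤ m, k ≤ n}`. -/
def sampleMatrix (b : ℕ → D → ℂ) (ϱ : D → ℝ≥0∞) (n : ℕ) {m : ℕ} (x : Fin m → D) :
    Matrix (Fin m) (Fin n) ℂ :=
  Matrix.of fun i k => invSqrtWeight ϱ (x i) * b k (x i)

/-- The weighted information mapping `N f = (ϱ(x_i)^{-1/2} f(x_i))_{i ≤ m}`. -/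
def weightedInfo (ϱ : D → ℝ≥0∞) {m : ℕ} (x : Fin m → D) (f : D → ℂ) : Fin m → ℂ :=
  fun i => invSqrtWeight ϱ (x i) * f (x i)

/-- The weighted least squares estimator `A_{m,n} f = ∑_{k ≤ n} (G⁺ N f)_k b_k`. -/
def leastSquares (b : ℕ → D → ℂ) (ϱ : D → ℝ≥0∞) (n : ℕ) {m : ℕ} (x : Fin m → D)
    (f : D → ℂ) : D → ℂ :=
  fun y => ∑ k : Fin n, (moorePenrose (sampleMatrix b ϱ n x) *ᵥ weightedInfo ϱ x f) k * b k y

/-- The worst-case error `sup_{f ∈ F} ‖f - A f‖_{L₂}`. -/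
def worstCaseError (μ : Measure D) (F : Set (D → ℂ)) (A : (D → ℂ) → (D → ℂ)) : ℝ≥0∞ :=
  ⨆ f ∈ F, eLpNorm (f - A f) 2 μ

end LeastSquares

end

/-! Write `P_n` for the projection onto the first `n` basis functions and `G` for the weighted
sample matrix. If `G*G ≥ m/2`, least squares reproduces `P_n f`, and the weighted residual of `f -
P_n f` at the sample points costs at most `(2/m)^{1/2}` times its Euclidean norm
(`eLpNorm_sub_leastSquares_le`). Split the residual into the dyadic blocks `[n 2^l, n 2^(l+1))`. If
the Gram matrix of block `l` is at most `32 m (1+l)² 2^(2δl)`, that block contributes at most `8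
(1+l) 2^(δl) ‖f - P_{n 2^l} f‖`. By near-optimality this is of order `(1+l)^(1+|β|) 2^((δ-α)l)`
times the rate at `n`, which is summable because `δ < α`. The spectral bounds do not involve `f`, so
one event serves all of `F₀`; countability is needed only to merge the null sets on which the
expansions fail to converge pointwise.

The density makes `ϱ^{-1/2} b_k` orthonormal under the sampling measure, with squared length at most
`2n` on the leading block and `C n 2^(2δl)` on block `l` (`exists_isBoundedIsotropic`). The spectral
bounds come from trace moments `E tr (S+c)^k` and `E tr (S+c)^{-q}`, where `S` is a sum of i.i.d.
rank one matrices. Writing one factor `S+c` as a sum over sample points leaves quadratic forms in a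
point `v` that is correlated with `S` only through its own term `vv*`. Removing this term costs a
shift of `c` by `R`, or a factor `K` per inverse power, where `K = 1 + R/c`. Both comparisons reduce
to Chebyshev's sum inequality on the spectrum (`quadForm_pow_mul_le`). The remaining matrix is
independent of `v`, so isotropy returns a trace and yields a recursion. Markov's inequality with
power `p ~ log n + l` and a union bound over the blocks finish the probabilistic part.

For the orthonormal system itself, spanning families of near-optimal subspaces of dimensions `1, 2,
4, …` are concatenated and orthonormalized (`exists_isNearOptimalSystem`). -/

/-! ### Rank one perturbations of positive semidefinite matrices. -/

section RankOne

open scoped ComplexOrder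

variable {ι : Type*} [Fintype ι]

/-- The quadratic form `v* A v` of a complex matrix. -/
def quadForm (A : Matrix ι ι ℂ) (v : ι → ℂ) : ℂ := star v ⬝ᵥ (A *ᵥ v)

/-- The rank one matrix `v v*`. -/
def rankOne (v : ι → ℂ) : Matrix ι ι ℂ := Matrix.vecMulVec v (star v)

theorem rankOne_mulVec (v u : ι → ℂ) : rankOne v *ᵥ u = (star v ⬝ᵥ u) • v := by
  ext i
  simp [rankOne, Matrix.vecMulVec_mulVec, mul_comm]

theorem rankOne_posSemidef (v : ι → ℂ) : (rankOne v).PosSemidef :=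
  Matrix.posSemidef_vecMulVec_self_star v

theorem quadForm_add (A B : Matrix ι ι ℂ) (v : ι → ℂ) :
    quadForm (A + B) v = quadForm A v + quadForm B v := by
  simp [quadForm, Matrix.add_mulVec]

theorem quadForm_smul (c : ℂ) (A : Matrix ι ι ℂ) (v : ι → ℂ) :
    quadForm (c • A) v = c * quadForm A v := by
  simp [quadForm, Matrix.smul_mulVec]

theorem quadForm_nonneg {A : Matrix ι ι ℂ} (hA : A.PosSemidef) (v : ι → ℂ) :
    0 ≤ quadForm A v := hA.dotProduct_mulVec_nonneg v

theorem quadForm_mul_rankOne_mul (A B : Matrix ι ι ℂ) (v : ι → ℂ) :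
    quadForm (A * rankOne v * B) v = quadForm A v * quadForm B v := by
  simp only [quadForm, ← Matrix.mulVec_mulVec, rankOne_mulVec, Matrix.mulVec_smul,
    dotProduct_smul, smul_eq_mul]
  ring

theorem trace_mul_rankOne (A : Matrix ι ι ℂ) (v : ι → ℂ) :
    (A * rankOne v).trace = quadForm A v := by
  simp only [rankOne, quadForm, Matrix.mul_vecMulVec, Matrix.trace_vecMulVec]
  rw [dotProduct_comm]

variable [DecidableEq ι]

theorem quadForm_one (v : ι → ℂ) : quadForm 1 v = ((∑ i, ‖v i‖ ^ 2 : ℝ) : ℂ) := by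
  simp only [quadForm, Matrix.one_mulVec, dotProduct, Pi.star_apply, RCLike.star_def,
    Complex.conj_mul']
  push_cast
  rfl

/-- A unitary diagonalization of a positive semidefinite matrix. -/
theorem Matrix.PosSemidef.exists_unitary_diag {A : Matrix ι ι ℂ} (hA : A.PosSemidef) :
    ∃ (U : Matrix ι ι ℂ) (d : ι → ℝ), (∀ i, 0 ≤ d i) ∧ Uᴴ * U = 1 ∧ U * Uᴴ = 1 ∧
      A = U * Matrix.diagonal (fun i => (d i : ℂ)) * Uᴴ :=
  ⟨hA.1.eigenvectorUnitary, hA.1.eigenvalues, hA.eigenvalues_nonneg,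
    Unitary.coe_star_mul_self hA.1.eigenvectorUnitary,
    Unitary.coe_mul_star_self hA.1.eigenvectorUnitary, hA.1.spectral_theorem⟩

theorem conj_diag_mul {U : Matrix ι ι ℂ} (hU : Uᴴ * U = 1) (d e : ι → ℂ) :
    (U * Matrix.diagonal d * Uᴴ) * (U * Matrix.diagonal e * Uᴴ) =
      U * Matrix.diagonal (fun i => d i * e i) * Uᴴ := by
  calc _ = U * Matrix.diagonal d * (Uᴴ * U) * Matrix.diagonal e * Uᴴ := by
        simp only [Matrix.mul_assoc]
    _ = _ := by
      rw [hU, Matrix.mul_one, Matrix.mul_assoc U, Matrix.diagonal_mul_diagonal]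

theorem conj_diag_pow {U : Matrix ι ι ℂ} (hU : Uᴴ * U = 1) (hU' : U * Uᴴ = 1) (d : ι → ℂ)
    (k : ℕ) :
    (U * Matrix.diagonal d * Uᴴ) ^ k = U * Matrix.diagonal (fun i => d i ^ k) * Uᴴ := by
  induction k with
  | zero => simp [hU']
  | succ k ih => rw [pow_succ, ih, conj_diag_mul hU]; simp [pow_succ]

theorem conj_diag_add_smul_one {U : Matrix ι ι ℂ} (hU' : U * Uᴴ = 1) (d : ι → ℂ) (c : ℂ) :
    U * Matrix.diagonal d * Uᴴ + c • (1 : Matrix ι ι ℂ) =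
      U * Matrix.diagonal (fun i => d i + c) * Uᴴ := by
  have : Matrix.diagonal (fun i => d i + c) = Matrix.diagonal d + c • (1 : Matrix ι ι ℂ) := by
    rw [Matrix.smul_one_eq_diagonal, Matrix.diagonal_add]
  rw [this, Matrix.mul_add, Matrix.add_mul]
  simp [hU']

theorem quadForm_conj_diag (U : Matrix ι ι ℂ) (d : ι → ℂ) (v : ι → ℂ) :
    quadForm (U * Matrix.diagonal d * Uᴴ) v = ∑ i, d i * ((‖(Uᴴ *ᵥ v) i‖ ^ 2 : ℝ) : ℂ) := by
  have h : star v ᵥ* U = star (Uᴴ *ᵥ v) := by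
    rw [Matrix.star_mulVec, Matrix.conjTranspose_conjTranspose]
  rw [quadForm, ← Matrix.mulVec_mulVec, ← Matrix.mulVec_mulVec, Matrix.dotProduct_mulVec, h]
  simp only [dotProduct, Matrix.mulVec_diagonal, Pi.star_apply, RCLike.star_def]
  refine Finset.sum_congr rfl fun i _ => ?_
  push_cast
  rw [← Complex.conj_mul']
  ring

theorem trace_conj_diag {U : Matrix ι ι ℂ} (hU : Uᴴ * U = 1) (d : ι → ℂ) :
    (U * Matrix.diagonal d * Uᴴ).trace = ∑ i, d i := by
  rw [Matrix.trace_mul_comm, ← Matrix.mul_assoc, hU, Matrix.one_mul, Matrix.trace_diagonal]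

theorem sum_sq_conjTranspose_mulVec {U : Matrix ι ι ℂ} (hU' : U * Uᴴ = 1) (v : ι → ℂ) :
    ∑ i, ‖(Uᴴ *ᵥ v) i‖ ^ 2 = ∑ i, ‖v i‖ ^ 2 := by
  have h := quadForm_conj_diag U (fun _ => 1) v
  rw [Matrix.diagonal_one, Matrix.mul_one, hU', quadForm_one] at h
  simp only [one_mul] at h
  exact_mod_cast h.symm

/-- The numbers `v* A^k (A + c)^j v` are moments of a finite measure on `[0, ∞)`. -/
theorem exists_moments {A : Matrix ι ι ℂ} (hA : A.PosSemidef) (v : ι → ℂ) :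
    ∃ d w : ι → ℝ, (∀ i, 0 ≤ d i) ∧ (∀ i, 0 ≤ w i) ∧ ∀ (k j : ℕ) (c : ℝ),
      quadForm (A ^ k * (A + (c : ℂ) • 1) ^ j) v =
        ((∑ i, d i ^ k * (d i + c) ^ j * w i : ℝ) : ℂ) := by
  obtain ⟨U, d, hd, hU, hU', rfl⟩ := hA.exists_unitary_diag
  refine ⟨d, fun i => ‖(Uᴴ *ᵥ v) i‖ ^ 2, hd, fun i => by positivity, fun k j c => ?_⟩
  rw [conj_diag_add_smul_one hU', conj_diag_pow hU hU', conj_diag_pow hU hU', conj_diag_mul hU,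
    quadForm_conj_diag]
  push_cast
  rfl

omit [DecidableEq ι] in
/-- Chebyshev's sum inequality with weights. -/
theorem chebyshev_weighted (f g w : ι → ℝ) (hw : ∀ i, 0 ≤ w i)
    (h : ∀ i j, 0 ≤ (f i - f j) * (g i - g j)) :
    (∑ i, f i * w i) * (∑ i, g i * w i) ≤ (∑ i, w i) * ∑ i, f i * g i * w i := by
  have key : 0 ≤ ∑ i, ∑ j, (f i - f j) * (g i - g j) * (w i * w j) :=
    Finset.sum_nonneg fun i _ => Finset.sum_nonneg fun j _ =>
      mul_nonneg (h i j) (mul_nonneg (hw i) (hw j))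
  have e : ∑ i, ∑ j, (f i - f j) * (g i - g j) * (w i * w j)
      = 2 * ((∑ i, w i) * ∑ i, f i * g i * w i)
        - 2 * ((∑ i, f i * w i) * (∑ i, g i * w i)) := by
    have e1 : ∀ i j, (f i - f j) * (g i - g j) * (w i * w j)
        = w j * (f i * g i * w i) + w i * (f j * g j * w j)
          - (f i * w i * (g j * w j) + f j * w j * (g i * w i)) := fun i j => by ring
    simp only [e1, Finset.sum_sub_distrib, Finset.sum_add_distrib, ← Finset.mul_sum,
      ← Finset.sum_mul]
    ring
  linarith

theorem pow_sub_mul_pow_sub_nonneg {a b c : ℝ} (ha : 0 ≤ a) (hb : 0 ≤ b) (hc : 0 ≤ c)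
    (i j : ℕ) : 0 ≤ (a ^ i - b ^ i) * ((a + c) ^ j - (b + c) ^ j) := by
  rcases le_total a b with h | h
  · refine mul_nonneg_of_nonpos_of_nonpos (sub_nonpos.2 ?_) (sub_nonpos.2 ?_) <;> gcongr
  · refine mul_nonneg (sub_nonneg.2 ?_) (sub_nonneg.2 ?_) <;> gcongr

/-- On the spectrum, `t^i` and `(t+c)^j` are both increasing in `t ≥ 0`, hence positively correlated
under the measure with weights `t^s w`. This correlation inequality drives both the positive and the
negative moment bounds. -/
theorem quadForm_pow_mul_le {A : Matrix ι ι ℂ} (hA : A.PosSemidef) (v : ι → ℂ) (s i j : ℕ)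
    {c : ℝ} (hc : 0 ≤ c) :
    quadForm (A ^ (s + i)) v * quadForm (A ^ s * (A + (c : ℂ) • 1) ^ j) v ≤
      quadForm (A ^ s) v * quadForm (A ^ (s + i) * (A + (c : ℂ) • 1) ^ j) v := by
  obtain ⟨d, w, hd, hw, h⟩ := exists_moments hA v
  have h0 : ∀ k, quadForm (A ^ k) v = ((∑ i, d i ^ k * w i : ℝ) : ℂ) := fun k => by
    simpa using h k 0 0
  rw [h0, h0, h, h]
  have := chebyshev_weighted (fun t => d t ^ i) (fun t => (d t + c) ^ j) (fun t => d t ^ s * w t)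
    (fun t => mul_nonneg (pow_nonneg (hd t) _) (hw t))
    (fun t u => pow_sub_mul_pow_sub_nonneg (hd t) (hd u) hc i j)
  rw [← Complex.ofReal_mul, ← Complex.ofReal_mul, Complex.real_le_real]
  convert this using 3 <;> ring_nf

omit [Fintype ι] in
theorem posSemidef_add_smul_one {A : Matrix ι ι ℂ} (hA : A.PosSemidef) {c : ℝ} (hc : 0 ≤ c) :
    (A + (c : ℂ) • 1).PosSemidef :=
  hA.add (Matrix.PosSemidef.one.smul (by exact_mod_cast hc))

theorem posSemidef_pow_mul_pow {A : Matrix ι ι ℂ} (hA : A.PosSemidef) {c : ℝ} (hc : 0 ≤ c)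
    (k j : ℕ) (v : ι → ℂ) : 0 ≤ quadForm (A ^ k * (A + (c : ℂ) • 1) ^ j) v := by
  obtain ⟨d, w, hd, hw, h⟩ := exists_moments hA v
  rw [h]
  have : 0 ≤ ∑ i, d i ^ k * (d i + c) ^ j * w i := Finset.sum_nonneg fun i _ =>
    mul_nonneg (mul_nonneg (pow_nonneg (hd i) _) (pow_nonneg (add_nonneg (hd i) hc) _)) (hw i)
  exact_mod_cast this

/-- A rank one perturbation is dominated, on its own direction, by a multiple of the identity. -/
theorem quadForm_pow_mul_add_rankOne_pow_le {A : Matrix ι ι ℂ} (hA : A.PosSemidef) {v : ι → ℂ}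
    {R : ℝ} (hR : ∑ i, ‖v i‖ ^ 2 ≤ R) (j l : ℕ) :
    quadForm (A ^ l * (A + rankOne v) ^ j) v ≤ quadForm (A ^ l * (A + (R : ℂ) • 1) ^ j) v := by
  have hR0 : 0 ≤ R := le_trans (by positivity) hR
  have hR1 : quadForm 1 v ≤ (R : ℂ) := by rw [quadForm_one]; exact_mod_cast hR
  induction j generalizing l with
  | zero => simp
  | succ j ih =>
    -- Expand only the leftmost factor. The rank one part splits the form into a product of two
    -- forms, which the correlation inequality recombines into one, at the price `v*v ≤ R`.
    have e1 : A ^ l * (A + rankOne v) ^ (j + 1) =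
        A ^ (l + 1) * (A + rankOne v) ^ j + A ^ l * rankOne v * (A + rankOne v) ^ j := by
      rw [pow_succ' (A + rankOne v), pow_succ]; noncomm_ring
    have e2 : A ^ l * (A + (R : ℂ) • 1) ^ (j + 1) =
        A ^ (l + 1) * (A + (R : ℂ) • 1) ^ j + (R : ℂ) • (A ^ l * (A + (R : ℂ) • 1) ^ j) := by
      rw [pow_succ' (A + (R : ℂ) • 1), pow_succ, Matrix.add_mul, Matrix.mul_add, Matrix.smul_mul,
        Matrix.one_mul, Matrix.mul_smul, Matrix.mul_assoc]
    rw [e1, e2, quadForm_add, quadForm_add, quadForm_smul, quadForm_mul_rankOne_mul]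
    refine add_le_add (ih (l + 1)) ?_
    have hl : 0 ≤ quadForm (A ^ l) v := quadForm_nonneg (hA.pow l) v
    have h0 := ih 0
    rw [pow_zero, Matrix.one_mul, Matrix.one_mul] at h0
    have hc := quadForm_pow_mul_le hA v 0 l j hR0
    simp only [zero_add, pow_zero, Matrix.one_mul] at hc
    calc _ ≤ quadForm (A ^ l) v * quadForm ((A + (R : ℂ) • 1) ^ j) v :=
          mul_le_mul_of_nonneg_left h0 hl
      _ ≤ _ := hc
      _ ≤ _ := mul_le_mul_of_nonneg_right hR1 (posSemidef_pow_mul_pow hA hR0 l j v)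

theorem quadForm_pow_mul_add_rankOne_pow_nonneg {A : Matrix ι ι ℂ} (hA : A.PosSemidef)
    (v : ι → ℂ) (j l : ℕ) : 0 ≤ quadForm (A ^ l * (A + rankOne v) ^ j) v := by
  induction j generalizing l with
  | zero => simpa using quadForm_nonneg (hA.pow l) v
  | succ j ih =>
    have e1 : A ^ l * (A + rankOne v) ^ (j + 1) =
        A ^ (l + 1) * (A + rankOne v) ^ j + A ^ l * rankOne v * (A + rankOne v) ^ j := by
      rw [pow_succ' (A + rankOne v), pow_succ]; noncomm_ring
    rw [e1, quadForm_add, quadForm_mul_rankOne_mul]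
    refine add_nonneg (ih _) (mul_nonneg (quadForm_nonneg (hA.pow l) v) ?_)
    simpa using ih 0

/-- Exchange the factors `A` for `A + vv*` one at a time. Each exchange adds the trace of `A^l vv*
(A + vv*)^j`, which is a nonnegative quadratic form even though the two matrices need not commute.
-/
theorem trace_pow_le_trace_add_rankOne_pow {A : Matrix ι ι ℂ} (hA : A.PosSemidef)
    (v : ι → ℂ) (k : ℕ) : (A ^ k).trace ≤ ((A + rankOne v) ^ k).trace := by
  have key : ∀ j l : ℕ, (A ^ (l + j)).trace ≤ (A ^ l * (A + rankOne v) ^ j).trace := by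
    intro j
    induction j with
    | zero => intro l; simp
    | succ j ih =>
      intro l
      have e1 : A ^ l * (A + rankOne v) ^ (j + 1) =
          A ^ (l + 1) * (A + rankOne v) ^ j + A ^ l * (rankOne v * (A + rankOne v) ^ j) := by
        rw [pow_succ' (A + rankOne v), pow_succ]; noncomm_ring
      have e2 : (A ^ l * (rankOne v * (A + rankOne v) ^ j)).trace =
          quadForm ((A + rankOne v) ^ j * A ^ l) v := by
        rw [← trace_mul_rankOne, Matrix.mul_assoc, Matrix.trace_mul_comm ((A + rankOne v) ^ j),
          Matrix.mul_assoc]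
      have e3 : 0 ≤ quadForm ((A + rankOne v) ^ j * A ^ l) v := by
        have h := quadForm_pow_mul_add_rankOne_pow_nonneg hA v j l
        have hs : ((A + rankOne v) ^ j * A ^ l) = (A ^ l * (A + rankOne v) ^ j)ᴴ := by
          rw [Matrix.conjTranspose_mul, ((hA.add (rankOne_posSemidef v)).pow j).1,
            (hA.pow l).1]
        have : quadForm ((A ^ l * (A + rankOne v) ^ j)ᴴ) v =
            star (quadForm (A ^ l * (A + rankOne v) ^ j) v) := by
          simp only [quadForm]
          rw [← Matrix.star_dotProduct, Matrix.star_mulVec, ← Matrix.dotProduct_mulVec]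
        rw [hs, this]
        exact star_nonneg_iff.2 h
      rw [e1, Matrix.trace_add, e2]
      calc (A ^ (l + (j + 1))).trace = (A ^ (l + 1 + j)).trace := by congr 2; ring
        _ ≤ _ := ih (l + 1)
        _ ≤ _ := le_add_of_nonneg_right e3
  simpa using key k 0

/-- Rank one updates change negative powers, on their own direction, by a controlled factor. -/
theorem quadForm_pow_mul_pow_le_of_eq_add {N P : Matrix ι ι ℂ} (hN : N.PosSemidef) {v : ι → ℂ}
    (h : P = N + N * rankOne v * P) {κ : ℝ} (hκ : 1 + quadForm P v = (κ : ℂ))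
    (hκ1 : 1 ≤ κ) (j l : ℕ) :
    quadForm (N ^ l * P ^ j) v ≤ (κ : ℂ) ^ j * quadForm (N ^ (l + j)) v := by
  have hκ0 : (1 : ℂ) ≤ κ := by exact_mod_cast hκ1
  have hκ00 : (0 : ℂ) ≤ κ := zero_le_one.trans hκ0
  -- The resolvent identity is substituted into the leftmost `P` only, so that powers of `P` are
  -- converted into powers of `N` one by one.
  have step : ∀ l j, quadForm (N ^ l * P ^ (j + 1)) v =
      quadForm (N ^ (l + 1) * P ^ j) v + quadForm (N ^ (l + 1)) v * quadForm (P ^ (j + 1)) v := by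
    intro l j
    have e1 : N ^ l * P ^ (j + 1) =
        N ^ (l + 1) * P ^ j + N ^ (l + 1) * rankOne v * P ^ (j + 1) := by
      conv_lhs => rw [pow_succ' P, h, Matrix.add_mul, ← h]
      rw [pow_succ' P, pow_succ N]; noncomm_ring
    rw [e1, quadForm_add, quadForm_mul_rankOne_mul]
  have hx1 : (κ : ℂ) * quadForm N v = quadForm P v := by
    have := step 0 0
    simp only [zero_add, pow_zero, Matrix.one_mul, pow_one, Matrix.mul_one] at this
    rw [← hκ, add_mul, one_mul, mul_comm (quadForm P v), ← this]
  -- The scalar form of Sherman–Morrison: `κ (1 - v*Nv) = 1`.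
  have ha : ∀ j, quadForm (P ^ (j + 1)) v = κ * quadForm (N * P ^ j) v := by
    intro j
    have := step 0 j
    simp only [zero_add, pow_zero, Matrix.one_mul, pow_one] at this
    have e : quadForm (N * P ^ j) v = (1 - quadForm N v) * quadForm (P ^ (j + 1)) v := by
      rw [sub_mul, one_mul]
      exact eq_sub_of_add_eq this.symm
    have e2 : (κ : ℂ) * (1 - quadForm N v) = 1 := by rw [mul_sub, hx1, ← hκ]; ring
    rw [e, ← mul_assoc, e2, one_mul]
  induction j generalizing l with
  | zero => simp
  | succ j ih =>
    rw [step, ha]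
    have h1 := ih 1
    rw [pow_one] at h1
    have hc := quadForm_pow_mul_le hN v 1 l j le_rfl
    simp only [Complex.ofReal_zero, zero_smul, add_zero, pow_one, ← pow_succ', ← pow_add] at hc
    have hl : 0 ≤ quadForm (N ^ (l + 1)) v := quadForm_nonneg (hN.pow _) v
    have hkj : (0 : ℂ) ≤ (κ : ℂ) ^ j := pow_nonneg hκ00 j
    -- After both terms are bounded inductively and the product is recombined, the new factor is `1
    -- + κ v*Nv = 1 + v*Pv = κ`.
    calc quadForm (N ^ (l + 1) * P ^ j) v + quadForm (N ^ (l + 1)) v * (κ * quadForm (N * P ^ j) v)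
        ≤ κ ^ j * quadForm (N ^ (l + 1 + j)) v +
          quadForm (N ^ (l + 1)) v * (κ * (κ ^ j * quadForm (N ^ (1 + j)) v)) := by
          gcongr
          exact ih (l + 1)
      _ = κ ^ j * quadForm (N ^ (l + 1 + j)) v +
          κ ^ j * κ * (quadForm (N ^ (1 + l)) v * quadForm (N ^ (j + 1)) v) := by
          rw [add_comm 1 l, add_comm 1 j]; ring
      _ ≤ κ ^ j * quadForm (N ^ (l + 1 + j)) v +
          κ ^ j * κ * (quadForm N v * quadForm (N ^ (1 + l + j)) v) := by
          gcongr
      _ = κ ^ (j + 1) * quadForm (N ^ (l + (j + 1))) v := by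
          have : l + 1 + j = l + (j + 1) := by ring
          have h2 : 1 + l + j = l + (j + 1) := by ring
          rw [this, h2]
          calc _ = κ ^ j * (1 + κ * quadForm N v) * quadForm (N ^ (l + (j + 1))) v := by ring
            _ = _ := by rw [hx1, hκ]; ring

end RankOne

/-! ### Spectral consequences of traces, and inverses under rank one updates. -/

section Inverse

open scoped ComplexOrder

variable {ι : Type*} [Fintype ι] [DecidableEq ι]

omit [Fintype ι] in
theorem posDef_add_smul_one {A : Matrix ι ι ℂ} (hA : A.PosSemidef) {c : ℝ} (hc : 0 < c) :
    (A + (c : ℂ) • 1).PosDef :=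
  Matrix.PosDef.posSemidef_add hA (Matrix.PosDef.one.smul (by exact_mod_cast hc))

theorem conj_diag_inv {U : Matrix ι ι ℂ} (hU : Uᴴ * U = 1) (hU' : U * Uᴴ = 1) {d : ι → ℂ}
    (hd : ∀ i, d i ≠ 0) :
    (U * Matrix.diagonal d * Uᴴ)⁻¹ = U * Matrix.diagonal (fun i => (d i)⁻¹) * Uᴴ := by
  refine Matrix.inv_eq_right_inv ?_
  rw [conj_diag_mul hU]
  simp [hd, hU']

/-- If the form of `S` exceeds the level `t` somewhere, then the trace of `S ^ p` is large. -/
theorem pow_le_trace_pow_of_lt_quadForm {S : Matrix ι ι ℂ} (hS : S.PosSemidef) {t : ℝ}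
    (ht : 0 ≤ t) {z : ι → ℂ} (hz : t * ∑ i, ‖z i‖ ^ 2 < (quadForm S z).re) (p : ℕ) :
    t ^ p ≤ ((S ^ p).trace).re := by
  obtain ⟨U, d, hd, hU, hU', rfl⟩ := hS.exists_unitary_diag
  rw [conj_diag_pow hU hU', trace_conj_diag hU]
  rw [quadForm_conj_diag, ← sum_sq_conjTranspose_mulVec hU', Finset.mul_sum] at hz
  obtain ⟨i, hi⟩ : ∃ i, t < d i := by
    by_contra! hcon
    refine absurd hz (not_lt.2 ?_)
    rw [Complex.re_sum]
    refine Finset.sum_le_sum fun i _ => ?_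
    rw [← Complex.ofReal_mul, Complex.ofReal_re]
    exact mul_le_mul_of_nonneg_right (hcon i) (by positivity)
  have : (∑ i, (d i : ℂ) ^ p).re = ∑ i, d i ^ p := by
    rw [← Complex.ofReal_re (∑ i, d i ^ p)]; push_cast; rfl
  rw [this]
  calc t ^ p ≤ d i ^ p := by gcongr
    _ ≤ _ := Finset.single_le_sum (f := fun i => d i ^ p) (fun j _ => pow_nonneg (hd j) p)
      (Finset.mem_univ i)

/-- If the form of `S` is below the level `s` somewhere, then `(S + c)⁻¹` has large traces. -/
theorem inv_pow_le_trace_inv_pow_of_quadForm_lt {S : Matrix ι ι ℂ} (hS : S.PosSemidef) {s c : ℝ}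
    (hc : 0 < c) {z : ι → ℂ} (hz : (quadForm S z).re < s * ∑ i, ‖z i‖ ^ 2) (p : ℕ) :
    ((s + c)⁻¹) ^ p ≤ ((((S + (c : ℂ) • 1)⁻¹) ^ p).trace).re := by
  obtain ⟨U, d, hd, hU, hU', rfl⟩ := hS.exists_unitary_diag
  have hdc : ∀ i, (d i : ℂ) + c ≠ 0 := fun i => by
    have : d i + c ≠ 0 := (add_pos_of_nonneg_of_pos (hd i) hc).ne'
    exact_mod_cast this
  rw [conj_diag_add_smul_one hU', conj_diag_inv hU hU' hdc, conj_diag_pow hU hU',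
    trace_conj_diag hU]
  rw [quadForm_conj_diag, ← sum_sq_conjTranspose_mulVec hU', Finset.mul_sum] at hz
  obtain ⟨i, hi⟩ : ∃ i, d i < s := by
    by_contra! hcon
    refine absurd hz (not_lt.2 ?_)
    rw [Complex.re_sum]
    refine Finset.sum_le_sum fun i _ => ?_
    rw [← Complex.ofReal_mul, Complex.ofReal_re]
    exact mul_le_mul_of_nonneg_right (hcon i) (by positivity)
  have : (∑ i, ((d i : ℂ) + c)⁻¹ ^ p).re = ∑ i, ((d i + c)⁻¹) ^ p := by
    rw [← Complex.ofReal_re (∑ i, ((d i + c)⁻¹) ^ p)]; push_cast; rfl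
  rw [this]
  have hpos : ∀ i, 0 < d i + c := fun i => add_pos_of_nonneg_of_pos (hd i) hc
  have hs : 0 < s + c := (hpos i).trans (by linarith)
  calc ((s + c)⁻¹) ^ p ≤ ((d i + c)⁻¹) ^ p := by
        have := hpos i
        gcongr
    _ ≤ _ := Finset.single_le_sum (f := fun i => ((d i + c)⁻¹) ^ p)
      (fun j _ => pow_nonneg (inv_nonneg.2 (hpos j).le) p) (Finset.mem_univ i)

theorem quadForm_inv_add_smul_one_le {S : Matrix ι ι ℂ} (hS : S.PosSemidef) {c R : ℝ}
    (hc : 0 < c) {v : ι → ℂ} (hR : ∑ i, ‖v i‖ ^ 2 ≤ R) :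
    quadForm (S + (c : ℂ) • 1)⁻¹ v ≤ ((R / c : ℝ) : ℂ) := by
  obtain ⟨U, d, hd, hU, hU', rfl⟩ := hS.exists_unitary_diag
  have hpos : ∀ i, 0 < d i + c := fun i => add_pos_of_nonneg_of_pos (hd i) hc
  have hdc : ∀ i, (d i : ℂ) + c ≠ 0 := fun i => by
    exact_mod_cast (hpos i).ne'
  rw [conj_diag_add_smul_one hU', conj_diag_inv hU hU' hdc, quadForm_conj_diag]
  have : ∑ i, ((d i : ℂ) + c)⁻¹ * ((‖(Uᴴ *ᵥ v) i‖ ^ 2 : ℝ) : ℂ) =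
      ((∑ i, (d i + c)⁻¹ * ‖(Uᴴ *ᵥ v) i‖ ^ 2 : ℝ) : ℂ) := by push_cast; rfl
  rw [this, Complex.real_le_real]
  calc ∑ i, (d i + c)⁻¹ * ‖(Uᴴ *ᵥ v) i‖ ^ 2 ≤ ∑ i, c⁻¹ * ‖(Uᴴ *ᵥ v) i‖ ^ 2 := by
        gcongr with i
        linarith [hd i]
    _ = c⁻¹ * ∑ i, ‖v i‖ ^ 2 := by rw [← Finset.mul_sum, sum_sq_conjTranspose_mulVec hU']
    _ ≤ c⁻¹ * R := by gcongr
    _ = R / c := by ring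

theorem inv_eq_inv_add_rankOne {M : Matrix ι ι ℂ} (hM : M.PosDef) (v : ι → ℂ) :
    M⁻¹ = (M + rankOne v)⁻¹ + (M + rankOne v)⁻¹ * rankOne v * M⁻¹ := by
  have hMV : (M + rankOne v).PosDef := hM.add_posSemidef (rankOne_posSemidef v)
  have h1 : M * M⁻¹ = 1 := Matrix.mul_nonsing_inv _ ((Matrix.isUnit_iff_isUnit_det _).1 hM.isUnit)
  have h2 : (M + rankOne v)⁻¹ * (M + rankOne v) = 1 :=
    Matrix.nonsing_inv_mul _ ((Matrix.isUnit_iff_isUnit_det _).1 hMV.isUnit)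
  calc M⁻¹ = ((M + rankOne v)⁻¹ * (M + rankOne v)) * M⁻¹ := by rw [h2, Matrix.one_mul]
    _ = (M + rankOne v)⁻¹ * (M * M⁻¹) + (M + rankOne v)⁻¹ * rankOne v * M⁻¹ := by noncomm_ring
    _ = _ := by rw [h1, Matrix.mul_one]

/-- This permits removing a sample point from an inverse Gram matrix at a cost of `K` per power. It
is the resolvent comparison with `N = (M + vv*)⁻¹` and `P = M⁻¹`. -/
theorem quadForm_inv_pow_le {M : Matrix ι ι ℂ} (hM : M.PosDef) {v : ι → ℂ} {K : ℝ}
    (hK : 1 + quadForm M⁻¹ v ≤ K) (j : ℕ) :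
    quadForm (M⁻¹ ^ j) v ≤ (K : ℂ) ^ j * quadForm ((M + rankOne v)⁻¹ ^ j) v := by
  have hMV : (M + rankOne v).PosDef := hM.add_posSemidef (rankOne_posSemidef v)
  have h0 : 0 ≤ quadForm M⁻¹ v := quadForm_nonneg hM.inv.posSemidef v
  obtain ⟨r, hr0, hr⟩ : ∃ r : ℝ, 0 ≤ r ∧ quadForm M⁻¹ v = r :=
    ⟨(quadForm M⁻¹ v).re, (Complex.nonneg_iff.1 h0).1, (Complex.ext rfl (by
      rw [Complex.ofReal_im]; exact (Complex.nonneg_iff.1 h0).2.symm))⟩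
  have h := quadForm_pow_mul_pow_le_of_eq_add hMV.inv.posSemidef (inv_eq_inv_add_rankOne hM v)
    (κ := 1 + r) (by rw [hr]; push_cast; rfl) (by linarith) j 0
  simp only [pow_zero, Matrix.one_mul, zero_add] at h
  refine h.trans (mul_le_mul_of_nonneg_right ?_ (quadForm_nonneg (hMV.inv.posSemidef.pow j) v))
  rw [hr] at hK
  have hK' : 1 + r ≤ K := by exact_mod_cast hK
  have : (1 + r) ^ j ≤ K ^ j := by gcongr
  exact_mod_cast this

/-- By Sherman–Morrison, `M⁻¹` is itself a rank one perturbation of `N = (M + vv*)⁻¹`, in the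
direction `Nv` with weight `1 + v*M⁻¹v`. The monotonicity of traces of powers then applies to `N`.
-/
theorem trace_inv_add_rankOne_pow_le {M : Matrix ι ι ℂ} (hM : M.PosDef) (v : ι → ℂ) (q : ℕ) :
    ((M + rankOne v)⁻¹ ^ q).trace ≤ (M⁻¹ ^ q).trace := by
  have hMV : (M + rankOne v).PosDef := hM.add_posSemidef (rankOne_posSemidef v)
  set N := (M + rankOne v)⁻¹ with hN
  have h0 : 0 ≤ quadForm M⁻¹ v := quadForm_nonneg hM.inv.posSemidef v
  obtain ⟨r, hr0, hr⟩ : ∃ r : ℝ, 0 ≤ r ∧ quadForm M⁻¹ v = r :=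
    ⟨(quadForm M⁻¹ v).re, (Complex.nonneg_iff.1 h0).1, (Complex.ext rfl (by
      rw [Complex.ofReal_im]; exact (Complex.nonneg_iff.1 h0).2.symm))⟩
  have hP := inv_eq_inv_add_rankOne hM v
  rw [← hN] at hP
  have hPv : M⁻¹ *ᵥ v = ((1 + r : ℝ) : ℂ) • (N *ᵥ v) := by
    conv_lhs => rw [hP, Matrix.add_mulVec, ← Matrix.mulVec_mulVec, ← Matrix.mulVec_mulVec,
      rankOne_mulVec, Matrix.mulVec_smul]
    have : star v ⬝ᵥ M⁻¹ *ᵥ v = r := hr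
    rw [this]; push_cast; rw [add_smul, one_smul]
  have hVP : rankOne v * M⁻¹ = Matrix.vecMulVec v (star (M⁻¹ *ᵥ v)) := by
    rw [Matrix.star_mulVec, hM.inv.1, rankOne, Matrix.vecMulVec_mul]
  have hPN : M⁻¹ = N + rankOne (((Real.sqrt (1 + r) : ℝ) : ℂ) • (N *ᵥ v)) := by
    conv_lhs => rw [hP, Matrix.mul_assoc, hVP, hPv, Matrix.mul_vecMulVec]
    congr 1
    ext i j
    simp only [rankOne, Matrix.vecMulVec_apply, Pi.smul_apply, Pi.star_apply, smul_eq_mul,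
      RCLike.star_def, map_mul, Complex.conj_ofReal]
    have : (((1 + r : ℝ) : ℂ)) = (Real.sqrt (1 + r) : ℂ) * (Real.sqrt (1 + r) : ℂ) := by
      rw [← Complex.ofReal_mul, Real.mul_self_sqrt (by linarith)]
    rw [this]; ring
  rw [hPN]
  exact trace_pow_le_trace_add_rankOne_pow hMV.inv.posSemidef _ q

end Inverse

/-! ### Gram matrices of samples. -/

section Gram

open scoped ComplexOrder

variable {ι : Type*} [Fintype ι] [DecidableEq ι] {D : Type*}

/-- The Gram matrix `∑ v(x_i) v(x_i)*` of a sample. -/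
def gramSum {m : ℕ} (v : D → ι → ℂ) (x : Fin m → D) : Matrix ι ι ℂ := ∑ i, rankOne (v (x i))

omit [DecidableEq ι] in
theorem gramSum_posSemidef {m : ℕ} (v : D → ι → ℂ) (x : Fin m → D) :
    (gramSum v x).PosSemidef := Matrix.posSemidef_sum _ fun _ _ => rankOne_posSemidef _

omit [Fintype ι] [DecidableEq ι] in
theorem gramSum_insertNth {m : ℕ} (v : D → ι → ℂ) (i : Fin (m + 1)) (y : D) (x : Fin m → D) :
    gramSum v (i.insertNth y x : Fin (m + 1) → D) = gramSum v x + rankOne (v y) := by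
  rw [gramSum, Fin.sum_univ_succAbove _ i]
  simp [gramSum, add_comm]

/-- The source of both moment recursions: with `Q` a power of `S + c` or of its inverse, it links
two consecutive exponents. -/
theorem trace_gramSum_add_mul {m : ℕ} (v : D → ι → ℂ) (x : Fin m → D) (c : ℂ)
    (Q : Matrix ι ι ℂ) :
    ((gramSum v x + c • 1) * Q).trace = ∑ i, quadForm Q (v (x i)) + c * Q.trace := by
  rw [Matrix.add_mul, Matrix.trace_add, gramSum, Finset.sum_mul, Matrix.trace_sum]
  congr 1
  · refine Finset.sum_congr rfl fun i _ => ?_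
    rw [Matrix.trace_mul_comm, trace_mul_rankOne]
  · simp

end Gram

/-! ### Moments and tail bounds for the spectrum of a random Gram matrix. -/

section Tail

open scoped ComplexOrder

variable {ι : Type*} [Fintype ι] [DecidableEq ι] {D : Type*} [MeasurableSpace D]

/-- A bounded isotropic random vector on a probability space. -/
structure IsBoundedIsotropic (ν : Measure D) (v : D → ι → ℂ) (R : ℝ) : Prop where
  measurable : Measurable v
  bound : ∀ y, ∑ i, ‖v y i‖ ^ 2 ≤ R
  isotropic : ∀ i j, ∫ y, star (v y i) * v y j ∂ν = if i = j then 1 else 0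

variable {ν : Measure D} {v : D → ι → ℂ} {R : ℝ}

theorem IsBoundedIsotropic.norm_apply_le (h : IsBoundedIsotropic ν v R) (y : D) (i : ι) :
    ‖v y i‖ ≤ Real.sqrt R := by
  refine Real.le_sqrt_of_sq_le ?_
  exact (Finset.single_le_sum (f := fun i => ‖v y i‖ ^ 2) (fun _ _ => by positivity)
    (Finset.mem_univ i)).trans (h.bound y)

theorem IsBoundedIsotropic.integrable [IsFiniteMeasure ν] (h : IsBoundedIsotropic ν v R)
    (i j : ι) : Integrable (fun y => star (v y i) * v y j) ν := by
  have hm : ∀ i, Measurable fun y => v y i := fun i => (measurable_pi_apply i).comp h.measurable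
  refine Integrable.of_bound (C := Real.sqrt R * Real.sqrt R) ?_ (.of_forall fun y => ?_)
  · exact ((continuous_star.measurable.comp (hm i)).mul (hm j)).aestronglyMeasurable
  · rw [norm_mul, norm_star]
    exact mul_le_mul (h.norm_apply_le y i) (h.norm_apply_le y j) (norm_nonneg _)
      (Real.sqrt_nonneg _)

omit [DecidableEq ι] in
theorem quadForm_eq_sum (Q : Matrix ι ι ℂ) (u : ι → ℂ) :
    quadForm Q u = ∑ i, ∑ j, Q i j * (star (u i) * u j) := by
  simp only [quadForm, dotProduct, Matrix.mulVec, Finset.mul_sum, Pi.star_apply]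
  exact Finset.sum_congr rfl fun i _ => Finset.sum_congr rfl fun j _ => by ring

/-- Isotropy replaces the products of entries of `v` by the identity matrix, which leaves only the
diagonal of `Q`. -/
theorem IsBoundedIsotropic.lintegral_quadForm [IsFiniteMeasure ν] (h : IsBoundedIsotropic ν v R)
    {Q : Matrix ι ι ℂ} (hQ : Q.PosSemidef) :
    ∫⁻ y, ENNReal.ofReal (quadForm Q (v y)).re ∂ν = ENNReal.ofReal Q.trace.re := by
  have hint : Integrable (fun y => quadForm Q (v y)) ν := by
    simp only [quadForm_eq_sum]
    exact integrable_finsetSum _ fun i _ => integrable_finsetSum _ fun j _ =>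
      (h.integrable i j).const_mul _
  have hval : ∫ y, quadForm Q (v y) ∂ν = Q.trace := by
    simp only [quadForm_eq_sum]
    rw [integral_finsetSum Finset.univ (f := fun i y => ∑ j, Q i j * (star (v y i) * v y j))
      fun i _ => integrable_finsetSum _ fun j _ => (h.integrable i j).const_mul _]
    refine Finset.sum_congr rfl fun i _ => ?_
    rw [integral_finsetSum Finset.univ (f := fun j y => Q i j * (star (v y i) * v y j))
      fun j _ => (h.integrable i j).const_mul _]
    simp_rw [integral_const_mul, h.isotropic]
    simp
  have h1 := ofReal_integral_eq_lintegral_ofReal hint.re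
    (.of_forall fun y => (Complex.nonneg_iff.1 (quadForm_nonneg hQ (v y))).1)
  have h2 := integral_re hint
  rw [hval] at h2
  rw [h2] at h1
  exact h1.symm

/-- Tonelli's theorem in leave-one-out form: point `i` is integrated first, with all other points
fixed. -/
theorem lintegral_pi_insertNth [SigmaFinite ν] {m : ℕ} (i : Fin (m + 1))
    {F : (Fin (m + 1) → D) → ℝ≥0∞} (hF : Measurable F) :
    ∫⁻ x, F x ∂Measure.pi (fun _ => ν) =
      ∫⁻ x, ∫⁻ y, F (i.insertNth y x) ∂ν ∂Measure.pi (fun _ => ν) := by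
  have hmp := (measurePreserving_piFinSuccAbove (fun _ : Fin (m + 1) => ν) i).symm
  rw [← hmp.lintegral_comp_emb (MeasurableEquiv.measurableEmbedding _),
    lintegral_prod_symm']
  · rfl
  · exact hF.comp (MeasurableEquiv.measurable _)

omit [DecidableEq ι] in
theorem measurable_comp_sample (hv : Measurable v) {m : ℕ} {G : (Fin m → ι → ℂ) → ℝ}
    (hG : Continuous G) : Measurable fun x : Fin m → D => G fun i => v (x i) :=
  hG.measurable.comp (measurable_pi_lambda _ fun i => hv.comp (measurable_pi_apply i))

omit [Fintype ι] [DecidableEq ι] in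
theorem continuous_rankOne : Continuous (rankOne : (ι → ℂ) → Matrix ι ι ℂ) := by
  unfold rankOne
  fun_prop

omit [DecidableEq ι] in
theorem continuous_quadForm : Continuous fun p : Matrix ι ι ℂ × (ι → ℂ) => quadForm p.1 p.2 := by
  unfold quadForm
  fun_prop

theorem measurable_trace_pow (hv : Measurable v) {m : ℕ} (c : ℂ) (k : ℕ) :
    Measurable fun x : Fin m → D => (((gramSum v x + c • 1) ^ k).trace).re := by
  refine measurable_comp_sample hv
    (G := fun w => (((∑ i, rankOne (w i) + c • 1) ^ k).trace).re) ?_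
  have := continuous_rankOne (ι := ι)
  fun_prop

theorem measurable_quadForm_pow (hv : Measurable v) {m : ℕ} (c : ℂ) (k : ℕ) (i : Fin m) :
    Measurable fun x : Fin m → D => (quadForm ((gramSum v x + c • 1) ^ k) (v (x i))).re := by
  refine measurable_comp_sample hv
    (G := fun w => (quadForm ((∑ i, rankOne (w i) + c • 1) ^ k) (w i)).re) ?_
  have := continuous_rankOne (ι := ι)
  have hc : Continuous fun w : Fin m → ι → ℂ => ((∑ i, rankOne (w i) + c • 1) ^ k, w i) := by
    fun_prop
  exact Complex.continuous_re.comp (continuous_quadForm.comp hc)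

theorem continuous_inv_gram {m : ℕ} {c : ℝ} (hc : 0 < c) :
    Continuous fun w : Fin m → ι → ℂ =>
      ((∑ i, rankOne (w i) + (c : ℂ) • (1 : Matrix ι ι ℂ))⁻¹) := by
  have := continuous_rankOne (ι := ι)
  have hcont : Continuous fun w : Fin m → ι → ℂ =>
      (∑ i, rankOne (w i) + (c : ℂ) • (1 : Matrix ι ι ℂ)) := by fun_prop
  have e : ∀ w : Fin m → ι → ℂ, (∑ i, rankOne (w i) + (c : ℂ) • (1 : Matrix ι ι ℂ))⁻¹ =
      (∑ i, rankOne (w i) + (c : ℂ) • (1 : Matrix ι ι ℂ)).det⁻¹ •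
      (∑ i, rankOne (w i) + (c : ℂ) • (1 : Matrix ι ι ℂ)).adjugate := fun w => by
    rw [Matrix.inv_def, Ring.inverse_eq_inv']
  simp_rw [e]
  refine (Continuous.inv₀ hcont.matrix_det fun w => ?_).smul hcont.matrix_adjugate
  have hp := posDef_add_smul_one
    (Matrix.posSemidef_sum Finset.univ fun i _ => rankOne_posSemidef (w i)) hc
  exact ((Matrix.isUnit_iff_isUnit_det _).1 hp.isUnit).ne_zero

theorem measurable_trace_inv_pow (hv : Measurable v) {m : ℕ} {c : ℝ} (hc : 0 < c) (k : ℕ) :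
    Measurable fun x : Fin m → D => ((((gramSum v x + (c : ℂ) • 1)⁻¹) ^ k).trace).re := by
  refine measurable_comp_sample hv
    (G := fun w => ((((∑ i, rankOne (w i) + (c : ℂ) • 1)⁻¹) ^ k).trace).re) ?_
  have := continuous_inv_gram (ι := ι) (m := m) hc
  fun_prop

theorem measurable_quadForm_inv_pow (hv : Measurable v) {m : ℕ} {c : ℝ} (hc : 0 < c) (k : ℕ)
    (i : Fin m) : Measurable fun x : Fin m → D =>
      (quadForm (((gramSum v x + (c : ℂ) • 1)⁻¹) ^ k) (v (x i))).re := by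
  refine measurable_comp_sample hv
    (G := fun w => (quadForm (((∑ i, rankOne (w i) + (c : ℂ) • 1)⁻¹) ^ k) (w i)).re) ?_
  have := continuous_inv_gram (ι := ι) (m := m) hc
  have hc : Continuous fun w : Fin m → ι → ℂ =>
      ((∑ i, rankOne (w i) + (c : ℂ) • 1)⁻¹ ^ k, w i) := by
    fun_prop
  exact Complex.continuous_re.comp (continuous_quadForm.comp hc)

/-- Moment bound for the upper tail of the Gram matrix. -/
theorem IsBoundedIsotropic.lintegral_trace_pow_le [IsProbabilityMeasure ν]
    (h : IsBoundedIsotropic ν v R) (hR : 0 ≤ R) (k m : ℕ) {c : ℝ} (hc : 0 ≤ c) :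
    ∫⁻ x : Fin m → D, ENNReal.ofReal (((gramSum v x + (c : ℂ) • 1) ^ k).trace).re
      ∂Measure.pi (fun _ => ν) ≤ ENNReal.ofReal (Fintype.card ι * (m + c + k * R) ^ k) := by
  induction k generalizing m c with
  | zero => simp
  | succ k ih =>
    have hexp : ∀ x : Fin m → D,
        ENNReal.ofReal (((gramSum v x + (c : ℂ) • 1) ^ (k + 1)).trace).re =
        ∑ i, ENNReal.ofReal (quadForm ((gramSum v x + (c : ℂ) • 1) ^ k) (v (x i))).re +
          ENNReal.ofReal c * ENNReal.ofReal (((gramSum v x + (c : ℂ) • 1) ^ k).trace).re := by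
      intro x
      have hp := (posSemidef_add_smul_one (gramSum_posSemidef v x) hc).pow k
      rw [pow_succ', trace_gramSum_add_mul, Complex.add_re, Complex.re_sum,
        Complex.re_ofReal_mul, ENNReal.ofReal_add, ENNReal.ofReal_sum_of_nonneg,
        ENNReal.ofReal_mul hc]
      · exact fun i _ => (Complex.nonneg_iff.1 (quadForm_nonneg hp _)).1
      · exact Finset.sum_nonneg fun i _ => (Complex.nonneg_iff.1 (quadForm_nonneg hp _)).1
      · exact mul_nonneg hc (Complex.nonneg_iff.1 hp.trace_nonneg).1
    simp_rw [hexp]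
    have hmq := fun i : Fin m => (measurable_quadForm_pow h.measurable (c : ℂ) k i).ennreal_ofReal
    have hmt := (measurable_trace_pow h.measurable (m := m) (c : ℂ) k).ennreal_ofReal
    rw [lintegral_add_left (by fun_prop), lintegral_finsetSum _ fun i _ => hmq i,
      lintegral_const_mul _ hmt]
    set B : ℝ := Fintype.card ι * (m + c + (k + 1 : ℕ) * R) ^ k with hB
    have hB0 : 0 ≤ B := by positivity
    have h1 : ∀ i : Fin m, ∫⁻ x : Fin m → D,
        ENNReal.ofReal (quadForm ((gramSum v x + (c : ℂ) • 1) ^ k) (v (x i))).re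
          ∂Measure.pi (fun _ => ν) ≤ ENNReal.ofReal B := by
      intro i
      obtain ⟨m, rfl⟩ : ∃ m', m = m' + 1 := ⟨m - 1, by have := i.pos; omega⟩
      rw [lintegral_pi_insertNth i (hmq i)]
      -- Replacing the contribution of point `i` by `R` times the identity leaves a matrix
      -- independent of that point. Isotropy then gives a trace with one point fewer and shift `c +
      -- R`, which is why the induction is over all `m` and `c`.
      calc _ ≤ ∫⁻ x : Fin m → D, ∫⁻ y, ENNReal.ofReal
            (quadForm ((gramSum v x + ((c + R : ℝ) : ℂ) • 1) ^ k) (v y)).re ∂ν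
            ∂Measure.pi (fun _ => ν) := by
            gcongr with x y
            simp only [Fin.insertNth_apply_same]
            rw [gramSum_insertNth]
            have hp := posSemidef_add_smul_one (gramSum_posSemidef v x) hc
            have := quadForm_pow_mul_add_rankOne_pow_le hp (h.bound y) k 0
            simp only [pow_zero, Matrix.one_mul] at this
            rw [add_right_comm, Complex.ofReal_add, add_smul, ← add_assoc]
            exact this
        _ = ∫⁻ x : Fin m → D, ENNReal.ofReal
            (((gramSum v x + ((c + R : ℝ) : ℂ) • 1) ^ k).trace).re ∂Measure.pi (fun _ => ν) := by
            refine lintegral_congr fun x => h.lintegral_quadForm ?_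
            exact (posSemidef_add_smul_one (gramSum_posSemidef v x) (add_nonneg hc hR)).pow k
        _ ≤ _ := ih m (add_nonneg hc hR)
        _ ≤ _ := by
          rw [hB]
          refine ENNReal.ofReal_le_ofReal ?_
          refine mul_le_mul_of_nonneg_left (pow_le_pow_left₀ (by positivity) ?_ k) (by positivity)
          push_cast
          linarith
    have h2 := ih m hc
    calc _ ≤ ∑ _i : Fin m, ENNReal.ofReal B + ENNReal.ofReal c * ENNReal.ofReal B := by
          gcongr with i
          · exact h1 i
          · refine h2.trans ?_
            rw [hB]
            gcongr
            linarith
      _ = ENNReal.ofReal ((m + c) * B) := by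
          rw [Finset.sum_const, Finset.card_univ, Fintype.card_fin, nsmul_eq_mul,
            ← ENNReal.ofReal_natCast, ← ENNReal.ofReal_mul (by positivity),
            ← ENNReal.ofReal_mul hc, ← ENNReal.ofReal_add (by positivity) (by positivity)]
          ring_nf
      _ ≤ _ := by
          refine ENNReal.ofReal_le_ofReal ?_
          rw [pow_succ, hB]
          have h3 : (m : ℝ) + c ≤ m + c + (k + 1 : ℕ) * R := by
            have : 0 ≤ ((k + 1 : ℕ) : ℝ) * R := by positivity
            linarith
          have h4 : (0 : ℝ) ≤ Fintype.card ι * (m + c + (k + 1 : ℕ) * R) ^ k := by positivity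
          calc _ ≤ (m + c + (k + 1 : ℕ) * R) *
                (Fintype.card ι * (m + c + (k + 1 : ℕ) * R) ^ k) :=
                mul_le_mul_of_nonneg_right h3 h4
            _ = _ := by ring

/-- Negative moment bound for the lower tail of the Gram matrix. -/
theorem IsBoundedIsotropic.lintegral_trace_inv_pow_le [IsProbabilityMeasure ν]
    (h : IsBoundedIsotropic ν v R) (hR : 0 ≤ R) (m p : ℕ) {c : ℝ} (hc : 0 < c) (q : ℕ)
    (hq : q ≤ p) :
    ENNReal.ofReal ((c + m * ((1 + R / c) ^ p)⁻¹) ^ q) *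
      ∫⁻ x : Fin m → D, ENNReal.ofReal ((((gramSum v x + (c : ℂ) • 1)⁻¹) ^ q).trace).re
      ∂Measure.pi (fun _ => ν) ≤ ENNReal.ofReal (Fintype.card ι) := by
  set K : ℝ := 1 + R / c with hK
  have hK1 : 1 ≤ K := by have : 0 ≤ R / c := by positivity
                         linarith
  induction q with
  | zero => simp
  | succ q ih =>
    refine le_trans ?_ (ih (by omega))
    rw [pow_succ, ENNReal.ofReal_mul (by positivity), mul_assoc]
    gcongr
    have hpos : ∀ x : Fin m → D, ((gramSum v x + (c : ℂ) • 1)⁻¹).PosDef := fun x =>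
      (posDef_add_smul_one (gramSum_posSemidef v x) hc).inv
    have hexp : ∀ x : Fin m → D,
        -- Here the recursion runs from `q + 1` down to `q`, by inserting `(S+c)(S+c)⁻¹`. It
        -- therefore bounds the higher negative moment by the lower one.
        ENNReal.ofReal ((((gramSum v x + (c : ℂ) • 1)⁻¹) ^ q).trace).re =
        ∑ i, ENNReal.ofReal
          (quadForm (((gramSum v x + (c : ℂ) • 1)⁻¹) ^ (q + 1)) (v (x i))).re +
          ENNReal.ofReal c *
            ENNReal.ofReal ((((gramSum v x + (c : ℂ) • 1)⁻¹) ^ (q + 1)).trace).re := by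
      intro x
      have hp := (hpos x).posSemidef.pow (q + 1)
      have e : ((gramSum v x + (c : ℂ) • 1)⁻¹) ^ q =
          (gramSum v x + (c : ℂ) • 1) * ((gramSum v x + (c : ℂ) • 1)⁻¹) ^ (q + 1) := by
        rw [pow_succ', ← Matrix.mul_assoc, Matrix.mul_nonsing_inv, Matrix.one_mul]
        exact (Matrix.isUnit_iff_isUnit_det _).1
          (posDef_add_smul_one (gramSum_posSemidef v x) hc).isUnit
      rw [e, trace_gramSum_add_mul, Complex.add_re, Complex.re_sum,
        Complex.re_ofReal_mul, ENNReal.ofReal_add, ENNReal.ofReal_sum_of_nonneg,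
        ENNReal.ofReal_mul hc.le]
      · exact fun i _ => (Complex.nonneg_iff.1 (quadForm_nonneg hp _)).1
      · exact Finset.sum_nonneg fun i _ => (Complex.nonneg_iff.1 (quadForm_nonneg hp _)).1
      · exact mul_nonneg hc.le (Complex.nonneg_iff.1 hp.trace_nonneg).1
    simp_rw [hexp]
    have hmq := fun i : Fin m =>
      (measurable_quadForm_inv_pow h.measurable hc (q + 1) i).ennreal_ofReal
    have hmt := (measurable_trace_inv_pow h.measurable (m := m) hc (q + 1)).ennreal_ofReal
    rw [lintegral_add_left (by fun_prop), lintegral_finsetSum _ fun i _ => hmq i,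
      lintegral_const_mul _ hmt, ENNReal.ofReal_add hc.le (by positivity), add_mul, add_comm]
    gcongr
    set ψ := ∫⁻ x : Fin m → D,
      ENNReal.ofReal ((((gramSum v x + (c : ℂ) • 1)⁻¹) ^ (q + 1)).trace).re
        ∂Measure.pi (fun _ => ν) with hψ
    have h1 : ∀ i : Fin m, ENNReal.ofReal ((K ^ p)⁻¹) * ψ ≤ ∫⁻ x : Fin m → D,
        ENNReal.ofReal (quadForm (((gramSum v x + (c : ℂ) • 1)⁻¹) ^ (q + 1)) (v (x i))).re
          ∂Measure.pi (fun _ => ν) := by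
      intro i
      obtain ⟨m, rfl⟩ : ∃ m', m = m' + 1 := ⟨m - 1, by have := i.pos; omega⟩
      rw [lintegral_pi_insertNth i (hmq i)]
      -- Dropping point `i` only increases the trace. Isotropy turns this trace into a form in the
      -- independent point, and reinserting the point costs `K^(q+1) ≤ K^p`; the fixed exponent `p`
      -- gives the same gain in every step.
      calc _ ≤ ENNReal.ofReal ((K ^ p)⁻¹) * ∫⁻ x : Fin m → D,
            ENNReal.ofReal ((((gramSum v x + (c : ℂ) • 1)⁻¹) ^ (q + 1)).trace).re
            ∂Measure.pi (fun _ => ν) := by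
            gcongr
            rw [hψ, lintegral_pi_insertNth i hmt]
            gcongr with x
            calc _ ≤ ∫⁻ _y : D, ENNReal.ofReal
                  ((((gramSum v x + (c : ℂ) • 1)⁻¹) ^ (q + 1)).trace).re ∂ν := by
                  gcongr with y
                  rw [gramSum_insertNth, add_right_comm]
                  exact trace_inv_add_rankOne_pow_le
                    (posDef_add_smul_one (gramSum_posSemidef v x) hc) (v y) (q + 1)
              _ = _ := by simp
        _ = ∫⁻ x : Fin m → D, ∫⁻ y, ENNReal.ofReal ((K ^ p)⁻¹) * ENNReal.ofReal
            (quadForm (((gramSum v x + (c : ℂ) • 1)⁻¹) ^ (q + 1)) (v y)).re ∂ν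
            ∂Measure.pi (fun _ => ν) := by
            rw [← lintegral_const_mul' _ _ ENNReal.ofReal_ne_top]
            refine lintegral_congr fun x => ?_
            rw [lintegral_const_mul' _ _ ENNReal.ofReal_ne_top, h.lintegral_quadForm]
            exact (posDef_add_smul_one (gramSum_posSemidef v x) hc).inv.posSemidef.pow _
        _ ≤ _ := by
            gcongr with x y
            simp only [Fin.insertNth_apply_same]
            rw [gramSum_insertNth, add_right_comm, ← ENNReal.ofReal_mul (by positivity)]
            refine ENNReal.ofReal_le_ofReal ?_
            have hpd := posDef_add_smul_one (gramSum_posSemidef v x) hc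
            have hle := quadForm_inv_pow_le hpd (v := v y) (K := K) (by
              rw [hK]; push_cast
              exact add_le_add le_rfl (by
                simpa using quadForm_inv_add_smul_one_le (gramSum_posSemidef v x) hc (h.bound y)))
              (q + 1)
            have hle' := (Complex.le_def.1 hle).1
            rw [← Complex.ofReal_pow, Complex.re_ofReal_mul] at hle'
            rw [inv_mul_le_iff₀ (by positivity)]
            refine hle'.trans ?_
            refine mul_le_mul_of_nonneg_right (pow_le_pow_right₀ hK1 hq) ?_
            exact (Complex.nonneg_iff.1 (quadForm_nonneg
              ((hpd.add_posSemidef (rankOne_posSemidef (v y))).inv.posSemidef.pow _) _)).1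
    calc _ = ∑ _i : Fin m, ENNReal.ofReal ((K ^ p)⁻¹) * ψ := by
          rw [Finset.sum_const, Finset.card_univ, Fintype.card_fin, nsmul_eq_mul,
            ENNReal.ofReal_mul (by positivity), ENNReal.ofReal_natCast, mul_assoc]
      _ ≤ _ := Finset.sum_le_sum fun i _ => h1 i

/-- Upper tail bound for the largest eigenvalue of the Gram matrix. -/
theorem IsBoundedIsotropic.measure_upper_le [IsProbabilityMeasure ν]
    (h : IsBoundedIsotropic ν v R) (hR : 0 ≤ R) (m p : ℕ) {t : ℝ} (ht : 0 < t) :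
    Measure.pi (fun _ : Fin m => ν)
      {x | ∃ z : ι → ℂ, t * ∑ i, ‖z i‖ ^ 2 < (quadForm (gramSum v x) z).re} ≤
      ENNReal.ofReal (Fintype.card ι * ((m + p * R) / t) ^ p) := by
  have hb := h.lintegral_trace_pow_le hR p m le_rfl
  simp only [Complex.ofReal_zero, zero_smul, add_zero] at hb
  have hm := (measurable_trace_pow h.measurable (m := m) 0 p).ennreal_ofReal
  simp only [zero_smul, add_zero] at hm
  have htp : 0 < t ^ p := by positivity
  calc _ ≤ Measure.pi (fun _ : Fin m => ν)
        {x | ENNReal.ofReal (t ^ p) ≤ ENNReal.ofReal (((gramSum v x) ^ p).trace).re} := by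
        refine measure_mono fun x ⟨z, hz⟩ => ?_
        exact ENNReal.ofReal_le_ofReal
          (pow_le_trace_pow_of_lt_quadForm (gramSum_posSemidef v x) ht.le hz p)
    _ ≤ _ := meas_ge_le_lintegral_div hm.aemeasurable (by simpa using htp)
        ENNReal.ofReal_ne_top
    _ ≤ ENNReal.ofReal (Fintype.card ι * (m + p * R) ^ p) / ENNReal.ofReal (t ^ p) := by
        gcongr
    _ = _ := by
        rw [← ENNReal.ofReal_div_of_pos htp, div_pow, mul_div_assoc]

/-- Lower tail bound for the smallest eigenvalue of the Gram matrix. -/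
theorem IsBoundedIsotropic.measure_lower_le [IsProbabilityMeasure ν]
    (h : IsBoundedIsotropic ν v R) (hR : 0 ≤ R) (m p : ℕ) {s c : ℝ} (hs : 0 ≤ s) (hc : 0 < c) :
    Measure.pi (fun _ : Fin m => ν)
      {x | ∃ z : ι → ℂ, (quadForm (gramSum v x) z).re < s * ∑ i, ‖z i‖ ^ 2} ≤
      ENNReal.ofReal (Fintype.card ι * ((s + c) / (c + m * ((1 + R / c) ^ p)⁻¹)) ^ p) := by
  have hb := h.lintegral_trace_inv_pow_le hR m p hc p le_rfl
  have hm := (measurable_trace_inv_pow h.measurable (m := m) hc p).ennreal_ofReal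
  have hsc : 0 < ((s + c)⁻¹) ^ p := by positivity
  set L := (c + m * ((1 + R / c) ^ p)⁻¹) with hL
  have hL0 : 0 < L := by positivity
  calc _ ≤ Measure.pi (fun _ : Fin m => ν)
        {x | ENNReal.ofReal (((s + c)⁻¹) ^ p) ≤
          ENNReal.ofReal ((((gramSum v x + (c : ℂ) • 1)⁻¹) ^ p).trace).re} := by
        refine measure_mono fun x ⟨z, hz⟩ => ?_
        exact ENNReal.ofReal_le_ofReal
          (inv_pow_le_trace_inv_pow_of_quadForm_lt (gramSum_posSemidef v x) hc hz p)
    _ ≤ _ := meas_ge_le_lintegral_div hm.aemeasurable (by simpa using hsc)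
        ENNReal.ofReal_ne_top
    _ ≤ (ENNReal.ofReal (Fintype.card ι) / ENNReal.ofReal (L ^ p)) /
          ENNReal.ofReal (((s + c)⁻¹) ^ p) := by
        gcongr
        rw [ENNReal.le_div_iff_mul_le (.inl (by simpa using pow_pos hL0 p))
          (.inl ENNReal.ofReal_ne_top), mul_comm]
        exact hb
    _ = _ := by
        rw [← ENNReal.ofReal_div_of_pos (by positivity), ← ENNReal.ofReal_div_of_pos hsc]
        congr 1
        rw [div_pow, inv_pow]
        field_simp

end Tail

/-! ### Existence of near-optimal orthonormal systems. -/

section NearOptimal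

variable {H : Type*} [NormedAddCommGroup H] [InnerProductSpace ℂ H]

theorem approxNumber_antitone (S : Set H) : Antitone (approxNumber S) := fun n m hnm =>
  le_iInf₂ fun T hT => iInf₂_le T (hT.trans (by exact_mod_cast hnm))

theorem norm_sub_starProjection_le (U : Submodule ℂ H) [FiniteDimensional ℂ U] (f : H) {w : H}
    (hw : w ∈ U) : ‖f - U.starProjection f‖ ≤ ‖f - w‖ := by
  rw [Submodule.starProjection_minimal]
  exact ciInf_le ⟨0, by rintro _ ⟨x, rfl⟩; exact norm_nonneg _⟩ (⟨w, hw⟩ : U)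

theorem enorm_sub_starProjection_le (U : Submodule ℂ H) [FiniteDimensional ℂ U] (f : H) {w : H}
    (hw : w ∈ U) : ‖f - U.starProjection f‖ₑ ≤ ‖f - w‖ₑ :=
  enorm_le_iff_norm_le.2 (norm_sub_starProjection_le U f hw)

theorem finite_range_of_rank_le {T : H →ₗ[ℂ] H} {n : ℕ} (hT : T.rank ≤ n) :
    FiniteDimensional ℂ (LinearMap.range T) :=
  Module.rank_lt_aleph0_iff.1 (lt_of_le_of_lt hT Cardinal.natCast_lt_aleph0)

/-- If the `n`-th approximation number vanishes, the set spans a space of dimension at most `n`. -/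
theorem rank_span_le_of_approxNumber_eq_zero {S : Set H} {n : ℕ} (h : approxNumber S n = 0) :
    Module.rank ℂ (Submodule.span ℂ S) ≤ n := by
  obtain ⟨B, hBS, hspan, hB⟩ := exists_linearIndependent ℂ S
  rw [← hspan, rank_span_set hB]
  by_contra! hlt
  have hle : ((n + 1 : ℕ) : Cardinal) ≤ Cardinal.mk B := by
    rw [Nat.cast_succ, ← Cardinal.succ_natCast]
    exact Order.succ_le_of_lt hlt
  obtain ⟨p, hpB, hp⟩ := Cardinal.le_mk_iff_exists_subset.1 hle
  obtain ⟨e⟩ : Nonempty (Fin (n + 1) ≃ p) := by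
    rw [← Cardinal.lift_mk_eq', hp]; simp
  have hf : LinearIndependent ℂ fun i => (e i : H) :=
    (hB.comp (fun i => (⟨e i, hpB (e i).2⟩ : B)) fun i j hij => by
      have : (e i : H) = e j := by simpa using hij
      exact e.injective (Subtype.ext this))
  -- Linear independence of a finite family is an open condition. A map of rank at most `n` that is
  -- uniformly `ε`-close to the identity on `n + 1` independent vectors would keep them independent,
  -- which is impossible.
  obtain ⟨ε, hε, hball⟩ := Metric.eventually_nhds_iff.1 hf.eventually
  have hlt' : approxNumber S n < ENNReal.ofReal ε := by rw [h]; simpa using hε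
  obtain ⟨T, hT⟩ := iInf_lt_iff.1 hlt'
  obtain ⟨hr, hsup⟩ := iInf_lt_iff.1 hT
  have hind : LinearIndependent ℂ fun i => T (e i) := by
    refine hball ?_
    rw [dist_pi_lt_iff hε]
    intro i
    have h1 : ‖(e i : H) - T (e i)‖ₑ < ENNReal.ofReal ε :=
      lt_of_le_of_lt (le_iSup₂ (f := fun f (_ : f ∈ S) => ‖f - T f‖ₑ) (e i : H)
        (hBS (hpB (e i).2))) hsup
    rw [← ofReal_norm, ENNReal.ofReal_lt_ofReal_iff hε] at h1
    rwa [dist_comm, dist_eq_norm]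
  have := finite_range_of_rank_le hr
  have hind' : LinearIndependent ℂ fun i => (⟨T (e i), LinearMap.mem_range_self T _⟩ :
      LinearMap.range T) := LinearIndependent.of_comp (LinearMap.range T).subtype hind
  have h2 := hind'.fintype_card_le_finrank
  have h3 : Module.finrank ℂ (LinearMap.range T) ≤ n := Module.finrank_le_of_rank_le hr
  rw [Fintype.card_fin] at h2
  omega

/-- A subspace of dimension at most `n` that approximates up to twice the approximation number. -/
theorem exists_subspace_approx (S : Set H) (n : ℕ) :
    ∃ W : Submodule ℂ H, Module.rank ℂ W ≤ n ∧ ∃ T : H → H, (∀ f, T f ∈ W) ∧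
      ∀ f ∈ S, ‖f - T f‖ₑ ≤ 2 * approxNumber S n := by
  classical
  -- The factor `2` leaves room to choose a near-minimizer only if the infimum is positive and
  -- finite. At zero, the span of `S` itself is small enough; at infinity nothing has to be shown.
  rcases eq_or_ne (approxNumber S n) 0 with h0 | h0
  · refine ⟨Submodule.span ℂ S, rank_span_le_of_approxNumber_eq_zero h0,
      fun f => if f ∈ S then f else 0, fun f => ?_, fun f hf => by simp [hf]⟩
    dsimp only
    split_ifs with hf
    · exact Submodule.subset_span hf
    · exact zero_mem _
  rcases eq_or_ne (approxNumber S n) ⊤ with ht | ht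
  · exact ⟨⊥, by simp, fun _ => 0, fun _ => by simp, fun f _ => by simp [ht]⟩
  · have hlt : approxNumber S n < 2 * approxNumber S n := by
      conv_lhs => rw [← one_mul (approxNumber S n)]
      exact ENNReal.mul_lt_mul_left h0 ht (by norm_num)
    obtain ⟨T, hT⟩ := iInf_lt_iff.1 hlt
    obtain ⟨hr, hsup⟩ := iInf_lt_iff.1 hT
    exact ⟨LinearMap.range T, hr, T, fun f => LinearMap.mem_range_self T f, fun f hf =>
      (le_iSup₂ (f := fun f (_ : f ∈ S) => ‖f - T f‖ₑ) f hf).trans hsup.le⟩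

theorem exists_fin_span_of_rank_le {W : Submodule ℂ H} {n : ℕ} (hW : Module.rank ℂ W ≤ n) :
    ∃ g : ℕ → H, W ≤ Submodule.span ℂ (g '' Set.Iio n) := by
  have : FiniteDimensional ℂ W :=
    Module.rank_lt_aleph0_iff.1 (lt_of_le_of_lt hW Cardinal.natCast_lt_aleph0)
  have hd : Module.finrank ℂ W ≤ n := Module.finrank_le_of_rank_le hW
  let e := Module.finBasis ℂ W
  refine ⟨fun i => if h : i < Module.finrank ℂ W then (e ⟨i, h⟩ : H) else 0, fun w hw => ?_⟩
  have h1 := congrArg W.subtype (e.sum_repr ⟨w, hw⟩)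
  rw [map_sum] at h1
  simp only [map_smul, Submodule.subtype_apply] at h1
  rw [← h1]
  refine Submodule.sum_mem _ fun i _ => Submodule.smul_mem _ _ (Submodule.subset_span ?_)
  exact ⟨i, lt_of_lt_of_le i.2 hd, by simp⟩

/-- In an infinite-dimensional space one can extend an orthonormal family so as to capture a
given vector. -/
theorem exists_unit_orthogonal_capturing (hinf : ¬ FiniteDimensional ℂ H) (U : Submodule ℂ H)
    [FiniteDimensional ℂ U] (w : H) :
    ∃ u : H, ‖u‖ = 1 ∧ u ∈ Uᗮ ∧ w ∈ U ⊔ Submodule.span ℂ {u} := by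
  obtain ⟨r, hr0, hrU, hw⟩ : ∃ r : H, r ≠ 0 ∧ r ∈ Uᗮ ∧ w ∈ U ⊔ Submodule.span ℂ {r} := by
    by_cases hwU : w ∈ U
    · have hne : Uᗮ ≠ ⊥ := fun h => hinf (by
        rw [Submodule.orthogonal_eq_bot_iff] at h
        subst h
        exact Module.finite_def.2 (by
          have : FiniteDimensional ℂ (⊤ : Submodule ℂ H) := ‹_›
          exact (Submodule.fg_iff_finiteDimensional _).2 this))
      obtain ⟨r, hr, hr0⟩ := Submodule.exists_mem_ne_zero_of_ne_bot hne
      exact ⟨r, hr0, hr, Submodule.mem_sup_left hwU⟩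
    · refine ⟨w - U.starProjection w, fun h => hwU ?_,
        Submodule.sub_starProjection_mem_orthogonal w, ?_⟩
      · rw [sub_eq_zero.1 h]; exact Submodule.starProjection_apply_mem U w
      · have : w = U.starProjection w + (w - U.starProjection w) := by abel
        have h2 := Submodule.add_mem_sup (Submodule.starProjection_apply_mem U w)
          (Submodule.mem_span_singleton_self (R := ℂ) (w - U.starProjection w))
        rwa [← this] at h2
  have hn : (‖r‖ : ℂ) ≠ 0 := by exact_mod_cast norm_ne_zero_iff.2 hr0
  refine ⟨((‖r‖ : ℂ)⁻¹) • r, ?_, Submodule.smul_mem _ _ hrU, ?_⟩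
  · rw [norm_smul, norm_inv, Complex.norm_real, norm_norm,
      inv_mul_cancel₀ (norm_ne_zero_iff.2 hr0)]
  · rwa [Submodule.span_singleton_smul_eq (IsUnit.mk0 _ (inv_ne_zero hn))]

theorem firstSpan_succ (b : ℕ → H) (n : ℕ) :
    firstSpan b (n + 1) = firstSpan b n ⊔ Submodule.span ℂ {b n} := by
  rw [firstSpan, firstSpan, ← Submodule.span_union]
  congr 1
  ext x
  simp only [Set.mem_range, Set.mem_union, Set.mem_singleton_iff]
  constructor
  · rintro ⟨k, rfl⟩
    rcases Nat.lt_succ_iff_lt_or_eq.1 k.2 with h | h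
    · exact .inl ⟨⟨k, h⟩, rfl⟩
    · exact .inr (by rw [h])
  · rintro (⟨k, rfl⟩ | rfl)
    · exact ⟨k.castSucc, rfl⟩
    · exact ⟨Fin.last n, rfl⟩

theorem mem_firstSpan (b : ℕ → H) {k n : ℕ} (h : k < n) : b k ∈ firstSpan b n :=
  Submodule.subset_span ⟨⟨k, h⟩, rfl⟩

theorem firstSpan_mono (b : ℕ → H) {m n : ℕ} (h : m ≤ n) : firstSpan b m ≤ firstSpan b n := by
  refine Submodule.span_le.2 ?_
  rintro _ ⟨k, rfl⟩
  exact mem_firstSpan b (k.2.trans_le h)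

/-- Orthonormalization of an arbitrary sequence in an infinite-dimensional space. -/
theorem exists_orthonormal_capturing (hinf : ¬ FiniteDimensional ℂ H) (v : ℕ → H) :
    ∃ b : ℕ → H, Orthonormal ℂ b ∧ ∀ k, v k ∈ firstSpan b (k + 1) := by
  choose pick hnorm horth hmem using
    fun (U : {U : Submodule ℂ H // FiniteDimensional ℂ U}) (w : H) =>
      have := U.2
      exists_unit_orthogonal_capturing hinf U.1 w
  let next : ℕ → {U : Submodule ℂ H // FiniteDimensional ℂ U} →
      {U : Submodule ℂ H // FiniteDimensional ℂ U} := fun k U =>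
    ⟨U.1 ⊔ Submodule.span ℂ {pick U (v k)}, by have := U.2; infer_instance⟩
  let U : ℕ → {U : Submodule ℂ H // FiniteDimensional ℂ U} := fun n =>
    Nat.rec ⟨⊥, inferInstance⟩ next n
  let b : ℕ → H := fun k => pick (U k) (v k)
  have hU : ∀ n, (U n).1 = firstSpan b n := by
    intro n
    induction n with
    | zero =>
      have : firstSpan b 0 = ⊥ := by simp [firstSpan]
      exact this.symm
    | succ n ih =>
      rw [firstSpan_succ, ← ih]
  have hlt : ∀ i j, i < j → inner ℂ (b i) (b j) = 0 := fun i j hij => by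
    have := horth (U j) (v j)
    rw [hU] at this
    exact (Submodule.mem_orthogonal _ _).1 this _ (mem_firstSpan b hij)
  refine ⟨b, ⟨fun k => hnorm _ _, fun i j hij => ?_⟩, fun k => ?_⟩
  · rcases lt_or_gt_of_ne hij with h | h
    · exact hlt i j h
    · exact inner_eq_zero_symm.1 (hlt j i h)
  · rw [firstSpan_succ, ← hU]
    exact hmem (U k) (v k)

/-- Near-optimal orthonormal systems exist in every infinite-dimensional space. -/
theorem exists_isNearOptimalSystem (hinf : ¬ FiniteDimensional ℂ H) (S : Set H) :
    ∃ b : ℕ → H, IsNearOptimalSystem S b := by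
  choose W hWr T hTW hT using exists_subspace_approx S
  choose g hg using fun n => exists_fin_span_of_rank_le (hWr n)
  -- With one-based indices, positions `2^i, …, 2^(i+1) - 1` list a spanning family of `W (2^i)`.
  -- This space is thus captured by the first `2^(i+1) - 1` basis vectors.
  let v : ℕ → H := fun k =>
    g (2 ^ Nat.log 2 (k + 1)) (k + 1 - 2 ^ Nat.log 2 (k + 1))
  obtain ⟨b, hb, hv⟩ := exists_orthonormal_capturing hinf v
  have hW : ∀ i n : ℕ, 2 ^ (i + 1) ≤ n + 1 → W (2 ^ i) ≤ firstSpan b n := by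
    intro i n hin
    refine (hg (2 ^ i)).trans (Submodule.span_le.2 ?_)
    rintro _ ⟨s, hs, rfl⟩
    have hs' : s < 2 ^ i := hs
    have hpos : 0 < 2 ^ i := by positivity
    have hlog : Nat.log 2 (2 ^ i + s - 1 + 1) = i := by
      rw [Nat.log_eq_iff (.inr ⟨by norm_num, by omega⟩)]
      rw [pow_succ]
      omega
    have h1 := hv (2 ^ i + s - 1)
    have e : v (2 ^ i + s - 1) = g (2 ^ i) s := by
      simp only [v, hlog]
      congr 1
      omega
    rw [e] at h1
    refine firstSpan_mono b ?_ h1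
    rw [pow_succ] at hin
    omega
  refine ⟨b, hb, fun n hn => iSup₂_le fun f hf => ?_⟩
  set j := ⌈(n : ℝ) / 4⌉₊ with hj
  have hj1 : 4 * j ≤ n + 3 := by
    have h1 : ((j : ℝ)) < n / 4 + 1 := Nat.ceil_lt_add_one (by positivity)
    have h2 : (4 * j : ℝ) < n + 4 := by linarith
    have h3 : 4 * j < n + 4 := by exact_mod_cast h2
    omega
  have hj0 : 0 < j := Nat.ceil_pos.2 (by positivity)
  set i := Nat.clog 2 j with hi
  have hji : j ≤ 2 ^ i := Nat.le_pow_clog (by norm_num) j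
  -- Rounding `⌈n/4⌉` up to a power of two at most doubles it, and listing all earlier families
  -- doubles again. This accounts for the factor `4`.
  have hi2 : 2 ^ (i + 1) ≤ n + 1 := by
    rcases Nat.eq_zero_or_pos i with h0 | h0
    · rw [h0]; simpa using hn
    · have h4 : 2 ^ (i - 1) < j := Nat.pow_lt_of_lt_clog (by omega)
      have h5 : 2 ^ (i + 1) = 4 * 2 ^ (i - 1) := by
        obtain ⟨i', hi'⟩ : ∃ i', i = i' + 1 := ⟨i - 1, by omega⟩
        rw [hi', Nat.add_sub_cancel, pow_succ, pow_succ]; ring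
      omega
  calc _ ≤ ‖f - T (2 ^ i) f‖ₑ :=
        enorm_sub_starProjection_le _ f (hW i n hi2 (hTW _ f))
    _ ≤ 2 * approxNumber S (2 ^ i) := hT _ f hf
    _ ≤ _ := by gcongr; exact approxNumber_antitone S hji

end NearOptimal

/-! ### The normalizing constant of the density. -/

section TailSum

/-- The comparison of `Σ k^{-s}` with its integral, in telescoping form. It comes from the
Bernoulli-type bound `(x/(x+1))^(1-s) ≥ 1 + (s-1)/(x+1)`. -/
theorem rpow_neg_le_telescope {s x : ℝ} (hs : 1 < s) (hx : 0 < x) :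
    (x + 1) ^ (-s) ≤ (x ^ (1 - s) - (x + 1) ^ (1 - s)) / (s - 1) := by
  have hx1 : 0 < x + 1 := by linarith
  rw [le_div_iff₀ (by linarith)]
  have hu : 0 < x / (x + 1) := by positivity
  have h1 : 1 + (s - 1) * (1 / (x + 1)) ≤ (x / (x + 1)) ^ (1 - s) := by
    rw [Real.rpow_def_of_pos hu]
    have h2 := Real.add_one_le_exp (Real.log (x / (x + 1)) * (1 - s))
    have h3 := Real.log_le_sub_one_of_pos hu
    have h4 : x / (x + 1) - 1 = -(1 / (x + 1)) := by field_simp; ring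
    rw [h4] at h3
    nlinarith
  rw [Real.div_rpow hx.le hx1.le, le_div_iff₀ (by positivity)] at h1
  have h5 : (x + 1) ^ (1 - s) = (x + 1) * (x + 1) ^ (-s) := by
    rw [sub_eq_add_neg, Real.rpow_add hx1, Real.rpow_one]
  have h6 : (1 / (x + 1)) * (x + 1) ^ (1 - s) = (x + 1) ^ (-s) := by
    rw [h5]; field_simp
  nlinarith

theorem sum_tail_rpow_le {s : ℝ} (hs : 1 < s) {n : ℕ} (hn : 1 ≤ n) (K : ℕ) :
    ∑ k ∈ Finset.range K, ((k + n + 1 : ℕ) : ℝ) ^ (-s) ≤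
      ((n : ℝ) ^ (1 - s) - ((n + K : ℕ) : ℝ) ^ (1 - s)) / (s - 1) := by
  induction K with
  | zero => simp
  | succ K ih =>
    rw [Finset.sum_range_succ]
    have hx : (0 : ℝ) < ((n + K : ℕ) : ℝ) := by
      exact_mod_cast (by omega : 0 < n + K)
    have h := rpow_neg_le_telescope hs hx
    have e1 : ((K + n + 1 : ℕ) : ℝ) = ((n + K : ℕ) : ℝ) + 1 := by push_cast; ring
    have e2 : ((n + (K + 1) : ℕ) : ℝ) = ((n + K : ℕ) : ℝ) + 1 := by push_cast; ring
    rw [e1, e2]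
    calc _ ≤ _ := add_le_add ih h
      _ = _ := by ring

theorem tsum_tail_rpow_le {δ : ℝ} (hδ : 1 / 2 < δ) {n : ℕ} (hn : 1 ≤ n) :
    ∑' k : ℕ, ENNReal.ofReal (((k + n + 1 : ℕ) : ℝ) ^ (-2 * δ)) ≤
      ENNReal.ofReal ((n : ℝ) ^ (1 - 2 * δ) / (2 * δ - 1)) := by
  refine ENNReal.tsum_le_of_sum_range_le fun K => ?_
  rw [← ENNReal.ofReal_sum_of_nonneg fun _ _ => by positivity]
  refine ENNReal.ofReal_le_ofReal ?_
  have h := sum_tail_rpow_le (s := 2 * δ) (by linarith) hn K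
  rw [← neg_mul] at h
  refine h.trans ?_
  have : (0 : ℝ) ≤ ((n + K : ℕ) : ℝ) ^ (1 - 2 * δ) := by positivity
  exact div_le_div_of_nonneg_right (by linarith) (by linarith)

theorem tsum_tail_rpow_ne_top {δ : ℝ} (hδ : 1 / 2 < δ) {n : ℕ} (hn : 1 ≤ n) :
    ∑' k : ℕ, ENNReal.ofReal (((k + n + 1 : ℕ) : ℝ) ^ (-2 * δ)) ≠ ⊤ :=
  ne_top_of_le_ne_top ENNReal.ofReal_ne_top (tsum_tail_rpow_le hδ hn)

theorem tsum_tail_rpow_ne_zero (δ : ℝ) (n : ℕ) :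
    ∑' k : ℕ, ENNReal.ofReal (((k + n + 1 : ℕ) : ℝ) ^ (-2 * δ)) ≠ 0 := by
  intro h
  have := ENNReal.tsum_eq_zero.1 h 0
  rw [ENNReal.ofReal_eq_zero] at this
  have h2 : (0 : ℝ) < ((0 + n + 1 : ℕ) : ℝ) ^ (-2 * δ) :=
    Real.rpow_pos_of_pos (by positivity) _
  linarith

end TailSum

/-! ### The sampling density and the isotropic vectors that it creates. -/

section Density

variable {D : Type*} [MeasurableSpace D] {μ : Measure D}

theorem aemeasurable_of_ae_eq {b : Lp ℂ 2 μ} {g : D → ℂ} (h : b =ᵐ[μ] g) : AEMeasurable g μ :=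
  ((Lp.aestronglyMeasurable b).congr h).aemeasurable

theorem lintegral_enorm_sq_of_ae_eq {b : Lp ℂ 2 μ} {g : D → ℂ} (h : b =ᵐ[μ] g) :
    ∫⁻ y, ‖g y‖ₑ ^ 2 ∂μ = ‖b‖ₑ ^ 2 := by
  rw [Lp.enorm_def, eLpNorm_congr_ae h, eLpNorm_eq_lintegral_rpow_enorm_toReal (by norm_num)
    (by norm_num), ← ENNReal.rpow_natCast, ← ENNReal.rpow_mul]
  norm_num

variable {b : ℕ → Lp ℂ 2 μ} {br : ℕ → D → ℂ}

theorem lintegral_enorm_sq_eq_one (hb : Orthonormal ℂ b) (hbr : ∀ k, b k =ᵐ[μ] br k) (k : ℕ) :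
    ∫⁻ y, ‖br k y‖ₑ ^ 2 ∂μ = 1 := by
  rw [lintegral_enorm_sq_of_ae_eq (hbr k), ← ofReal_norm, hb.1 k]
  simp

theorem aemeasurable_samplingDensity (hbr : ∀ k, b k =ᵐ[μ] br k) (δ : ℝ) (n : ℕ) :
    AEMeasurable (samplingDensity br δ n) μ := by
  have h : ∀ k, AEMeasurable (fun y => ‖br k y‖ₑ ^ 2) μ := fun k =>
    (aemeasurable_of_ae_eq (hbr k)).enorm.pow_const 2
  unfold samplingDensity
  refine AEMeasurable.const_mul (AEMeasurable.add ?_ ?_) _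
  · exact (Finset.aemeasurable_fun_sum _ fun k _ => h k).const_mul _
  · exact (AEMeasurable.tsum fun k => (h (k + n)).const_mul _).const_mul _

theorem lintegral_samplingDensity (hb : Orthonormal ℂ b) (hbr : ∀ k, b k =ᵐ[μ] br k) {δ : ℝ}
    (hδ : 1 / 2 < δ) {n : ℕ} (hn : 1 ≤ n) : ∫⁻ y, samplingDensity br δ n y ∂μ = 1 := by
  have h : ∀ k, AEMeasurable (fun y => ‖br k y‖ₑ ^ 2) μ := fun k =>
    (aemeasurable_of_ae_eq (hbr k)).enorm.pow_const 2
  have h1 : AEMeasurable (fun y => ∑ k ∈ Finset.range n, ‖br k y‖ₑ ^ 2) μ :=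
    Finset.aemeasurable_fun_sum _ fun k _ => h k
  have h2 : ∀ k, AEMeasurable (fun y =>
      ENNReal.ofReal (((k + n + 1 : ℕ) : ℝ) ^ (-2 * δ)) * ‖br (k + n) y‖ₑ ^ 2) μ := fun k =>
    (h (k + n)).const_mul _
  have h3 := AEMeasurable.tsum (L := .unconditional ℕ) h2
  unfold samplingDensity
  rw [lintegral_const_mul'' _ ((h1.const_mul _).fun_add (h3.const_mul _)),
    lintegral_add_left' (h1.const_mul _), lintegral_const_mul'' _ h1, lintegral_const_mul'' _ h3,
    lintegral_finsetSum' _ fun k _ => h k, lintegral_tsum h2]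
  simp_rw [lintegral_const_mul'' _ (h _), lintegral_enorm_sq_eq_one hb hbr, mul_one]
  rw [ENNReal.inv_mul_cancel (tsum_tail_rpow_ne_zero δ n) (tsum_tail_rpow_ne_top hδ hn)]
  simp only [Finset.sum_const, Finset.card_range, nsmul_eq_mul, mul_one]
  rw [ENNReal.inv_mul_cancel (by exact_mod_cast (by omega : n ≠ 0)) (ENNReal.natCast_ne_top n),
    one_add_one_eq_two]
  exact ENNReal.inv_mul_cancel (by norm_num) (by norm_num)

omit [MeasurableSpace D] in
theorem sum_range_enorm_sq_le_samplingDensity (br : ℕ → D → ℂ) (δ : ℝ) {n : ℕ} (hn : 1 ≤ n)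
    (y : D) : ∑ k ∈ Finset.range n, ‖br k y‖ₑ ^ 2 ≤
      ENNReal.ofReal (2 * n) * samplingDensity br δ n y := by
  have hn0 : (n : ℝ≥0∞) ≠ 0 := by exact_mod_cast (by omega : n ≠ 0)
  have h2 : ENNReal.ofReal (2 * n) = n * 2 := by
    rw [mul_comm, ENNReal.ofReal_mul (by positivity)]; simp
  rw [samplingDensity, h2]
  calc ∑ k ∈ Finset.range n, ‖br k y‖ₑ ^ 2
      = (n * (n : ℝ≥0∞)⁻¹) * (2 * 2⁻¹) * ∑ k ∈ Finset.range n, ‖br k y‖ₑ ^ 2 := by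
        rw [ENNReal.mul_inv_cancel hn0 (ENNReal.natCast_ne_top n),
          ENNReal.mul_inv_cancel (by norm_num) (by norm_num)]
        simp
    _ = n * 2 * (2⁻¹ * ((n : ℝ≥0∞)⁻¹ * ∑ k ∈ Finset.range n, ‖br k y‖ₑ ^ 2)) := by ring
    _ ≤ _ := by
        gcongr
        exact le_self_add

omit [MeasurableSpace D] in
-- All weights up to index `N` are at least `N^{-2δ}`, so the block is dominated by the second half
-- of the density. The price is `2 Z_n N^(2δ)`, with `Z_n` bounded by the integral comparison.
theorem sum_Ico_enorm_sq_le_samplingDensity (br : ℕ → D → ℂ) {δ : ℝ} (hδ : 1 / 2 < δ) {n : ℕ}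
    (hn : 1 ≤ n) (M N : ℕ) (hM : n ≤ M) (y : D) :
    ∑ k ∈ Finset.Ico M N, ‖br k y‖ₑ ^ 2 ≤
      ENNReal.ofReal (2 * ((n : ℝ) ^ (1 - 2 * δ) / (2 * δ - 1)) * (N : ℝ) ^ (2 * δ)) *
        samplingDensity br δ n y := by
  set w : ℕ → ℝ≥0∞ := fun k => ENNReal.ofReal (((k + n + 1 : ℕ) : ℝ) ^ (-2 * δ)) with hw
  set Z : ℝ≥0∞ := ∑' k, w k with hZ
  have hZ0 : Z ≠ 0 := tsum_tail_rpow_ne_zero δ n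
  have hZt : Z ≠ ⊤ := tsum_tail_rpow_ne_top hδ hn
  set T : ℝ≥0∞ := ∑' k, w k * ‖br (k + n) y‖ₑ ^ 2 with hT
  have hq : (0 : ℝ) ≤ (n : ℝ) ^ (1 - 2 * δ) / (2 * δ - 1) :=
    div_nonneg (by positivity) (by linarith)
  have hsum : ∑ k ∈ Finset.Ico M N, ‖br k y‖ₑ ^ 2 ≤ ENNReal.ofReal ((N : ℝ) ^ (2 * δ)) * T := by
    have hT' : ∑ k ∈ Finset.Ico M N, w (k - n) * ‖br k y‖ₑ ^ 2 ≤ T := by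
      have : ∑ k ∈ Finset.Ico M N, w (k - n) * ‖br k y‖ₑ ^ 2 =
          ∑ k ∈ Finset.Ico (M - n) (N - n), w k * ‖br (k + n) y‖ₑ ^ 2 := by
        rcases le_or_gt N n with hN | hN
        · rw [Finset.Ico_eq_empty (by omega), Finset.Ico_eq_empty (by omega)]; simp
        · have h := Finset.sum_Ico_add' (fun k => w (k - n) * ‖br k y‖ₑ ^ 2) (M - n) (N - n) n
          rw [Nat.sub_add_cancel hM, Nat.sub_add_cancel hN.le] at h
          rw [← h]
          simp
      rw [this]
      exact ENNReal.sum_le_tsum _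
    refine le_trans ?_ (mul_le_mul_right hT' _)
    rw [Finset.mul_sum]
    refine Finset.sum_le_sum fun k hk => ?_
    rw [Finset.mem_Ico] at hk
    rw [← mul_assoc]
    refine le_mul_of_one_le_left' ?_
    have e : k - n + n + 1 = k + 1 := by omega
    simp only [hw, e]
    rw [← ENNReal.ofReal_mul (by positivity)]
    refine ENNReal.one_le_ofReal.2 ?_
    have hk1 : (0 : ℝ) < ((k + 1 : ℕ) : ℝ) := by positivity
    have hle : ((k + 1 : ℕ) : ℝ) ≤ N := by exact_mod_cast hk.2
    have h1 : ((k + 1 : ℕ) : ℝ) ^ (2 * δ) ≤ (N : ℝ) ^ (2 * δ) :=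
      Real.rpow_le_rpow hk1.le hle (by linarith)
    have h2 : ((k + 1 : ℕ) : ℝ) ^ (2 * δ) * ((k + 1 : ℕ) : ℝ) ^ (-2 * δ) = 1 := by
      rw [← Real.rpow_add hk1]; simp
    rw [← h2]
    exact mul_le_mul_of_nonneg_right h1 (by positivity)
  calc _ ≤ _ := hsum
    _ = ENNReal.ofReal ((N : ℝ) ^ (2 * δ)) * ((Z * Z⁻¹) * (2 * 2⁻¹) * T) := by
        rw [ENNReal.mul_inv_cancel hZ0 hZt, ENNReal.mul_inv_cancel (by norm_num) (by norm_num)]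
        simp
    _ = 2 * Z * ENNReal.ofReal ((N : ℝ) ^ (2 * δ)) * (2⁻¹ * (Z⁻¹ * T)) := by ring
    _ ≤ _ := by
        rw [ENNReal.ofReal_mul (by positivity), ENNReal.ofReal_mul (by norm_num),
          ENNReal.ofReal_ofNat]
        unfold samplingDensity
        gcongr
        · exact tsum_tail_rpow_le hδ hn
        · exact le_add_self

/-- The normalized system is a bounded isotropic vector under the sampling measure. -/
theorem exists_isBoundedIsotropic (hb : Orthonormal ℂ b) (hbr : ∀ k, b k =ᵐ[μ] br k)
    {ϱ : D → ℝ≥0∞} (hϱ : AEMeasurable ϱ μ) (hϱ1 : ∫⁻ y, ϱ y ∂μ ≠ ⊤) (I : Finset ℕ) {R : ℝ}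
    (hR : 0 ≤ R) (hI : ∀ y, ∑ k ∈ I, ‖br k y‖ₑ ^ 2 ≤ ENNReal.ofReal R * ϱ y) :
    ∃ v : D → I → ℂ, IsBoundedIsotropic (μ.withDensity ϱ) v R ∧
      ∀ᵐ y ∂μ.withDensity ϱ, ∀ k : I, v y k = invSqrtWeight ϱ y * br k y := by
  classical
  have hm : ∀ k : I, AEMeasurable (fun y => invSqrtWeight ϱ y * br k y) μ := fun k =>
    (Complex.measurable_ofReal.comp_aemeasurable (hϱ.ennreal_toReal.pow_const _)).mul
      (aemeasurable_of_ae_eq (hbr k))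
  -- The representatives are only almost everywhere measurable. A measurable modification, cut off
  -- where it exceeds the bound, restores measurability and the bound at every point.
  set u : D → I → ℂ := fun y k => (hm k).mk _ y with hu
  have hum : Measurable u := measurable_pi_lambda _ fun k => (hm k).measurable_mk
  have hG : MeasurableSet {y | ∑ k, ‖u y k‖ ^ 2 ≤ R} :=
    measurableSet_le (by fun_prop) measurable_const
  have hfin : ∀ᵐ y ∂μ, ϱ y < ⊤ := ae_lt_top' hϱ hϱ1
  have hbound : ∀ y, ϱ y < ⊤ → ∑ k : I, ‖invSqrtWeight ϱ y * br k y‖ ^ 2 ≤ R := by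
    intro y hy
    have h1 : ∑ k : I, ‖br k y‖ ^ 2 ≤ R * (ϱ y).toReal := by
      have h2 := ENNReal.toReal_mono (ENNReal.mul_ne_top ENNReal.ofReal_ne_top hy.ne) (hI y)
      rw [ENNReal.toReal_mul, ENNReal.toReal_ofReal hR,
        ENNReal.toReal_sum fun k _ => by finiteness] at h2
      rw [Finset.sum_coe_sort I fun k => ‖br k y‖ ^ 2]
      simpa using h2
    have h3 : ∀ k : I, ‖invSqrtWeight ϱ y * br k y‖ ^ 2 = (ϱ y).toReal⁻¹ * ‖br k y‖ ^ 2 := by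
      intro k
      rw [norm_mul, mul_pow, invSqrtWeight, Complex.norm_real, Real.norm_eq_abs, sq_abs,
        ← Real.rpow_natCast, ← Real.rpow_mul ENNReal.toReal_nonneg]
      norm_num [Real.rpow_neg_one]
    simp_rw [h3, ← Finset.mul_sum]
    rcases (ENNReal.toReal_nonneg (a := ϱ y)).eq_or_lt with h0 | h0
    · rw [← h0]; simpa using hR
    · rw [inv_mul_le_iff₀ h0, mul_comm]; exact h1
  have huμ : ∀ᵐ y ∂μ, ∀ k : I, invSqrtWeight ϱ y * br k y = u y k :=
    ae_all_iff.2 fun k => (hm k).ae_eq_mk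
  have hac := withDensity_absolutelyContinuous μ ϱ
  have hvae : ∀ᵐ y ∂μ, ∀ k : I,
      Set.indicator {y | ∑ k, ‖u y k‖ ^ 2 ≤ R} u y k = invSqrtWeight ϱ y * br k y := by
    filter_upwards [huμ, hfin] with y h1 h2 k
    have : y ∈ {y | ∑ k, ‖u y k‖ ^ 2 ≤ R} := by
      have := hbound y h2
      simpa only [Set.mem_ofPred_eq, h1] using this
    rw [Set.indicator_of_mem this, h1]
  refine ⟨Set.indicator {y | ∑ k, ‖u y k‖ ^ 2 ≤ R} u, ⟨hum.indicator hG, fun y => ?_,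
    fun i j => ?_⟩, hac.ae_le hvae⟩
  · by_cases hy : y ∈ {y | ∑ k, ‖u y k‖ ^ 2 ≤ R}
    · rw [Set.indicator_of_mem hy]; exact hy
    · rw [Set.indicator_of_notMem hy]; simpa using hR
  · rw [integral_withDensity_eq_integral_toReal_smul₀ hϱ hfin]
    have hinner : inner ℂ (b i) (b j) = if i = j then (1 : ℂ) else 0 := by
      rw [orthonormal_iff_ite.1 hb]; simp only [Subtype.ext_iff]
    rw [← hinner, L2.inner_def]
    refine integral_congr_ae ?_
    filter_upwards [hvae, hfin, hbr i, hbr j] with y h1 h2 h3 h4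
    rw [h1, h1, h3, h4]
    simp only [RCLike.inner_apply, RCLike.star_def, map_mul, invSqrtWeight, Complex.conj_ofReal,
      Complex.real_smul]
    -- Where the density vanishes the weight cannot be cancelled, but domination by `ϱ` forces the
    -- basis functions to vanish there too.
    rcases eq_or_ne (ϱ y) 0 with h0 | h0
    · have h5 : ‖br i y‖ₑ ^ 2 = 0 := by
        have h6 := (Finset.single_le_sum (f := fun k => ‖br k y‖ₑ ^ 2)
          (fun _ _ => zero_le) i.2).trans (hI y)
        rw [h0, mul_zero] at h6
        exact le_antisymm h6 zero_le
      have h7 : br i y = 0 := by simpa using h5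
      simp [h7]
    · have hpos : 0 < (ϱ y).toReal := ENNReal.toReal_pos h0 h2.ne
      have h8 : (ϱ y).toReal * ((ϱ y).toReal ^ (-(1 / 2) : ℝ) * (ϱ y).toReal ^ (-(1 / 2) : ℝ))
          = 1 := by
        rw [← Real.rpow_add hpos]
        norm_num [Real.rpow_neg_one]
        exact mul_inv_cancel₀ hpos.ne'
      have h9 : ((ϱ y).toReal : ℂ) * ((((ϱ y).toReal ^ (-(1 / 2) : ℝ) : ℝ) : ℂ) *
          (((ϱ y).toReal ^ (-(1 / 2) : ℝ) : ℝ) : ℂ)) = 1 := by exact_mod_cast h8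
      linear_combination (starRingEnd ℂ (br i y) * br j y) * h9

end Density

/-! ### Orthogonal expansions, in the norm and pointwise. -/

section Expansion

variable {H : Type*} [NormedAddCommGroup H] [InnerProductSpace ℂ H] {b : ℕ → H}

theorem Orthonormal.norm_sq_sum_smul (hb : Orthonormal ℂ b) (I : Finset ℕ) (c : ℕ → ℂ) :
    ‖∑ k ∈ I, c k • b k‖ ^ 2 = ∑ k ∈ I, ‖c k‖ ^ 2 := by
  have h : inner ℂ (∑ k ∈ I, c k • b k) (∑ k ∈ I, c k • b k) =
      ∑ k ∈ I, starRingEnd ℂ (c k) * c k := hb.inner_sum c c I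
  rw [inner_self_eq_norm_sq_to_K] at h
  simp only [Complex.conj_mul'] at h
  refine Complex.ofReal_injective ?_
  push_cast
  exact h

theorem Orthonormal.starProjection_firstSpan (hb : Orthonormal ℂ b) (n : ℕ) (F : H) :
    (firstSpan b n).starProjection F = ∑ k ∈ Finset.range n, inner ℂ (b k) F • b k := by
  refine Submodule.eq_starProjection_of_mem_orthogonal ?_ ?_
  · exact Submodule.sum_mem _ fun k hk =>
      Submodule.smul_mem _ _ (mem_firstSpan b (Finset.mem_range.1 hk))
  · rw [Submodule.mem_orthogonal]
    intro u hu
    induction hu using Submodule.span_induction with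
    | mem u hu =>
      obtain ⟨k, rfl⟩ := hu
      rw [inner_sub_right, hb.inner_right_sum (fun k => inner ℂ (b k) F)
        (Finset.mem_range.2 k.2), sub_self]
    | zero => simp
    | add u w _ _ h1 h2 => rw [inner_add_left, h1, h2, add_zero]
    | smul a u _ h => rw [inner_smul_left, h, mul_zero]

/-- Subtracting the projection does not change coefficients with index at least `M`, so Bessel's
inequality applies to the remainder. -/
theorem Orthonormal.sum_Ico_norm_inner_sq_le (hb : Orthonormal ℂ b) (M N : ℕ) (F : H) :
    ∑ k ∈ Finset.Ico M N, ‖inner ℂ (b k) F‖ ^ 2 ≤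
      ‖F - (firstSpan b M).starProjection F‖ ^ 2 := by
  have h : ∀ k ∈ Finset.Ico M N, ‖inner ℂ (b k) F‖ ^ 2 =
      ‖inner ℂ (b k) (F - (firstSpan b M).starProjection F)‖ ^ 2 := by
    intro k hk
    rw [Finset.mem_Ico] at hk
    have h0 : inner ℂ (b k) ((firstSpan b M).starProjection F) = 0 := by
      rw [hb.starProjection_firstSpan, inner_sum]
      refine Finset.sum_eq_zero fun j hj => ?_
      rw [Finset.mem_range] at hj
      rw [inner_smul_right, hb.2 (by omega : k ≠ j), mul_zero]
    rw [inner_sub_right, h0, sub_zero]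
  rw [Finset.sum_congr rfl h]
  exact hb.sum_inner_products_le _

end Expansion

section PointwiseExpansion

variable {D : Type*} [MeasurableSpace D] {μ : Measure D}
  {b : ℕ → Lp ℂ 2 μ} {br : ℕ → D → ℂ}

theorem coeFn_sum_smul_ae_eq (hbr : ∀ k, b k =ᵐ[μ] br k) (I : Finset ℕ) (c : ℕ → ℂ) :
    (∑ k ∈ I, c k • b k : Lp ℂ 2 μ) =ᵐ[μ] fun y => ∑ k ∈ I, c k * br k y := by
  classical
  induction I using Finset.induction_on with
  | empty => simp only [Finset.sum_empty]; exact Lp.coeFn_zero ℂ 2 μ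
  | insert k I hk ih =>
    rw [Finset.sum_insert hk]
    filter_upwards [Lp.coeFn_add (c k • b k) (∑ k ∈ I, c k • b k), Lp.coeFn_smul (c k) (b k), ih,
      hbr k] with y h1 h2 h3 h4
    rw [h1, Pi.add_apply, h2, Pi.smul_apply, h3, h4, Finset.sum_insert hk, smul_eq_mul]

theorem sub_sum_ae_eq (hb : Orthonormal ℂ b) (hbr : ∀ k, b k =ᵐ[μ] br k) {F : Lp ℂ 2 μ}
    {f : D → ℂ} (hF : F =ᵐ[μ] f) (n : ℕ) :
    (F - (firstSpan b n).starProjection F : Lp ℂ 2 μ) =ᵐ[μ]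
      fun y => f y - ∑ k ∈ Finset.range n, inner ℂ (b k) F * br k y := by
  rw [hb.starProjection_firstSpan]
  filter_upwards [hF, Lp.coeFn_sub F (∑ k ∈ Finset.range n, inner ℂ (b k) F • b k),
    coeFn_sum_smul_ae_eq hbr (Finset.range n) fun k => inner ℂ (b k) F] with y h1 h2 h3
  rw [h2, Pi.sub_apply, h1, h3]

/-- Partial sums of an orthogonal expansion converge almost everywhere along a subsequence with
square summable errors. -/
theorem ae_tendsto_partialSums (hb : Orthonormal ℂ b) (hbr : ∀ k, b k =ᵐ[μ] br k)
    {F : Lp ℂ 2 μ} {f : D → ℂ} (hF : F =ᵐ[μ] f) (M : ℕ → ℕ)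
    (hM : ∑' l, ‖F - (firstSpan b (M l)).starProjection F‖ₑ ^ 2 ≠ ⊤) :
    ∀ᵐ y ∂μ, Filter.Tendsto (fun l => ∑ k ∈ Finset.range (M l), inner ℂ (b k) F * br k y)
      Filter.atTop (nhds (f y)) := by
  set r : ℕ → D → ℂ := fun l y => f y - ∑ k ∈ Finset.range (M l), inner ℂ (b k) F * br k y with hr
  have hae := fun l => sub_sum_ae_eq hb hbr hF (M l)
  have hmeas : ∀ l, AEMeasurable (fun y => ‖r l y‖ₑ ^ 2) μ := fun l =>
    (aemeasurable_of_ae_eq (hae l)).enorm.pow_const 2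
  have hint : ∫⁻ y, ∑' l, ‖r l y‖ₑ ^ 2 ∂μ ≠ ⊤ := by
    rw [lintegral_tsum hmeas]
    simpa only [hr, lintegral_enorm_sq_of_ae_eq (hae _)] using hM
  filter_upwards [ae_lt_top' (AEMeasurable.tsum (L := .unconditional ℕ) hmeas) hint] with y hy
  -- Summable squared `L₂` errors make the pointwise squared errors summable almost everywhere, so
  -- they tend to zero.
  have h1 := ENNReal.tendsto_atTop_zero_of_tsum_ne_top hy.ne
  have h2 : Filter.Tendsto (fun l => ‖r l y‖ ^ 2) Filter.atTop (nhds 0) := by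
    have h3 := (ENNReal.tendsto_toReal ENNReal.zero_ne_top).comp h1
    simpa [Function.comp_def] using h3
  have h4 : Filter.Tendsto (fun l => ‖r l y‖) Filter.atTop (nhds 0) := by
    have h5 := h2.sqrt
    simpa [Real.sqrt_sq] using h5
  have h6 : Filter.Tendsto (fun l => r l y) Filter.atTop (nhds 0) :=
    tendsto_zero_iff_norm_tendsto_zero.2 h4
  have h7 := h6.const_sub (f y)
  simpa [hr] using h7

end PointwiseExpansion

/-! ### Stability of least squares and the blockwise residual bound. -/

section LeastSquaresStability

theorem sum_norm_sq_eq_re_star_dotProduct {m : ℕ} (y : Fin m → ℂ) :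
    ∑ i, ‖y i‖ ^ 2 = (star y ⬝ᵥ y).re := by
  simp only [dotProduct, Pi.star_apply, RCLike.star_def, Complex.conj_mul', Complex.re_sum]
  refine Finset.sum_congr rfl fun i _ => ?_
  rw [← Complex.ofReal_pow, Complex.ofReal_re]

theorem Matrix.IsHermitian.sum_norm_sq_mulVec_le {m : ℕ} {P : Matrix (Fin m) (Fin m) ℂ}
    (hP : P.IsHermitian) (hPP : P * P = P) (y : Fin m → ℂ) :
    ∑ i, ‖(P *ᵥ y) i‖ ^ 2 ≤ ∑ i, ‖y i‖ ^ 2 := by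
  have h1 : star (P *ᵥ y) ⬝ᵥ (P *ᵥ y) = star y ⬝ᵥ (P *ᵥ y) := by
    rw [Matrix.star_mulVec, hP.eq, ← Matrix.dotProduct_mulVec, Matrix.mulVec_mulVec, hPP]
  have h2 : star (P *ᵥ y) ⬝ᵥ y = star y ⬝ᵥ (P *ᵥ y) := by
    rw [Matrix.star_mulVec, hP.eq, ← Matrix.dotProduct_mulVec]
  have h3 : star (y - P *ᵥ y) ⬝ᵥ (y - P *ᵥ y) = star y ⬝ᵥ y - star (P *ᵥ y) ⬝ᵥ (P *ᵥ y) := by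
    rw [star_sub, sub_dotProduct, dotProduct_sub, dotProduct_sub, h1, h2]; ring
  have h4 : 0 ≤ (star (y - P *ᵥ y) ⬝ᵥ (y - P *ᵥ y)).re := by
    rw [← sum_norm_sq_eq_re_star_dotProduct]; positivity
  rw [h3, Complex.sub_re] at h4
  rw [sum_norm_sq_eq_re_star_dotProduct, sum_norm_sq_eq_re_star_dotProduct]
  linarith

variable {m n : ℕ} {G : Matrix (Fin m) (Fin n) ℂ} {X : Matrix (Fin n) (Fin m) ℂ} {κ : ℝ}

theorem IsMoorePenrose.mulVec_mulVec_of_bound (h : IsMoorePenrose G X) (hκ : 0 < κ)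
    (hG : ∀ z, κ * ∑ k, ‖z k‖ ^ 2 ≤ ∑ i, ‖(G *ᵥ z) i‖ ^ 2) (z : Fin n → ℂ) :
    X *ᵥ (G *ᵥ z) = z := by
  have h1 : G *ᵥ (X *ᵥ (G *ᵥ z) - z) = 0 := by
    rw [Matrix.mulVec_sub, Matrix.mulVec_mulVec, Matrix.mulVec_mulVec, h.mul_mul_self, sub_self]
  have h2 := hG (X *ᵥ (G *ᵥ z) - z)
  rw [h1] at h2
  simp only [Pi.zero_apply, norm_zero, ne_eq, OfNat.ofNat_ne_zero, not_false_eq_true, zero_pow,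
    Finset.sum_const_zero] at h2
  have h3 : ∑ k, ‖(X *ᵥ (G *ᵥ z) - z) k‖ ^ 2 = 0 :=
    le_antisymm (nonpos_of_mul_nonpos_right h2 hκ) (by positivity)
  refine sub_eq_zero.1 (funext fun k => ?_)
  have h4 := (Finset.sum_eq_zero_iff_of_nonneg fun _ _ => by positivity).1 h3 k (Finset.mem_univ k)
  simpa using h4

/-- The Penrose equations make `GX` an orthogonal projection, hence a contraction; the lower bound
for `G` then transfers this to `X`. -/
theorem IsMoorePenrose.sum_norm_sq_mulVec_le (h : IsMoorePenrose G X)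
    (hG : ∀ z, κ * ∑ k, ‖z k‖ ^ 2 ≤ ∑ i, ‖(G *ᵥ z) i‖ ^ 2) (y : Fin m → ℂ) :
    κ * ∑ k, ‖(X *ᵥ y) k‖ ^ 2 ≤ ∑ i, ‖y i‖ ^ 2 := by
  refine (hG _).trans ?_
  rw [Matrix.mulVec_mulVec]
  exact h.left_hermitian.sum_norm_sq_mulVec_le (by rw [← Matrix.mul_assoc, h.mul_mul_self]) y

variable {D : Type*} [MeasurableSpace D] {μ : Measure D}
  {b : ℕ → Lp ℂ 2 μ} {br : ℕ → D → ℂ}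

/-- Error bound for weighted least squares in terms of the residual at the sample points. -/
theorem eLpNorm_sub_leastSquares_le (hb : Orthonormal ℂ b) (hbr : ∀ k, b k =ᵐ[μ] br k)
    {F : Lp ℂ 2 μ} {f : D → ℂ} (hF : F =ᵐ[μ] f) (ϱ : D → ℝ≥0∞) (x : Fin m → D) (hκ : 0 < κ)
    (hG : ∀ z, κ * ∑ k, ‖z k‖ ^ 2 ≤ ∑ i, ‖(sampleMatrix br ϱ n x *ᵥ z) i‖ ^ 2) {B : ℝ}
    (hB : 0 ≤ B) (hres : ∑ i, ‖invSqrtWeight ϱ (x i) * (f (x i) -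
      ∑ k ∈ Finset.range n, inner ℂ (b k) F * br k (x i))‖ ^ 2 ≤ κ * B ^ 2) :
    eLpNorm (f - leastSquares br ϱ n x f) 2 μ ≤
      ENNReal.ofReal (‖F - (firstSpan b n).starProjection F‖ + B) := by
  set X := moorePenrose (sampleMatrix br ϱ n x) with hX
  have hMP : IsMoorePenrose (sampleMatrix br ϱ n x) X := moorePenrose_spec _
  set r : Fin m → ℂ := fun i => invSqrtWeight ϱ (x i) * (f (x i) -
      ∑ k ∈ Finset.range n, inner ℂ (b k) F * br k (x i)) with hr
  -- The data are those of `P_n f` plus the residual. The pseudoinverse recovers the coefficients of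
  -- `P_n f` exactly, so only its action on the residual causes an additional error.
  have hN : weightedInfo ϱ x f =
      sampleMatrix br ϱ n x *ᵥ (fun k : Fin n => inner ℂ (b k) F) + r := by
    funext i
    simp only [weightedInfo, sampleMatrix, Matrix.mulVec, dotProduct, Matrix.of_apply,
      Pi.add_apply, hr]
    rw [Fin.sum_univ_eq_sum_range
      (fun k => invSqrtWeight ϱ (x i) * br k (x i) * inner ℂ (b k) F) n, mul_sub, Finset.mul_sum]
    have : ∀ k, invSqrtWeight ϱ (x i) * br k (x i) * inner ℂ (b k) F =
      invSqrtWeight ϱ (x i) * (inner ℂ (b k) F * br k (x i)) := fun k => by ring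
    simp only [this]
    ring
  have hXN : X *ᵥ weightedInfo ϱ x f = (fun k : Fin n => inner ℂ (b k) F) + X *ᵥ r := by
    rw [hN, Matrix.mulVec_add, hMP.mulVec_mulVec_of_bound hκ hG]
  set d : ℕ → ℂ := fun k => if h : k < n then (X *ᵥ r) ⟨k, h⟩ else 0 with hd
  have hdk : ∀ k : Fin n, (X *ᵥ r) k = d k := fun k => by simp [hd]
  set W : Lp ℂ 2 μ := (F - (firstSpan b n).starProjection F) -
    ∑ k ∈ Finset.range n, d k • b k with hW
  have hWf : W =ᵐ[μ] f - leastSquares br ϱ n x f := by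
    filter_upwards [sub_sum_ae_eq hb hbr hF n, coeFn_sum_smul_ae_eq hbr (Finset.range n) d,
      Lp.coeFn_sub (F - (firstSpan b n).starProjection F) (∑ k ∈ Finset.range n, d k • b k)]
      with y h1 h2 h3
    rw [hW, h3, Pi.sub_apply, h1, h2, Pi.sub_apply, leastSquares, ← hX, hXN]
    simp only [Pi.add_apply, hdk]
    rw [Fin.sum_univ_eq_sum_range (fun k => (inner ℂ (b k) F + d k) * br k y) n]
    simp only [add_mul, Finset.sum_add_distrib]
    ring
  have hdn : ‖∑ k ∈ Finset.range n, d k • b k‖ ≤ B := by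
    refine abs_le_of_sq_le_sq' ?_ hB |>.2
    rw [hb.norm_sq_sum_smul, ← Fin.sum_univ_eq_sum_range (fun k => ‖d k‖ ^ 2) n]
    simp only [← hdk]
    exact le_of_mul_le_mul_left ((hMP.sum_norm_sq_mulVec_le hG r).trans hres) hκ
  rw [← eLpNorm_congr_ae hWf, ← Lp.enorm_def, ← ofReal_norm]
  exact ENNReal.ofReal_le_ofReal ((norm_sub_le _ _).trans (by gcongr))

theorem sum_Ico_dyadic (g : ℕ → ℂ) (n L : ℕ) :
    ∑ k ∈ Finset.range n, g k + ∑ l ∈ Finset.range L,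
      ∑ k ∈ Finset.Ico (n * 2 ^ l) (n * 2 ^ (l + 1)), g k =
      ∑ k ∈ Finset.range (n * 2 ^ L), g k := by
  induction L with
  | zero => simp
  | succ L ih =>
    rw [Finset.sum_range_succ, ← add_assoc, ih]
    exact Finset.sum_range_add_sum_Ico _
      (Nat.mul_le_mul_left n (Nat.pow_le_pow_right (by norm_num) (Nat.le_succ L)))

/-- The weighted residual is controlled blockwise. -/
theorem sum_norm_sq_residual_le (hb : Orthonormal ℂ b) (F : Lp ℂ 2 μ) (f : D → ℂ)
    (s : Fin m → ℂ) (x : Fin m → D) {T e : ℕ → ℝ} (hT : ∀ l, 0 ≤ T l)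
    (hblock : ∀ l, ∀ d : ℕ → ℂ, ∑ i, ‖∑ k ∈ Finset.Ico (n * 2 ^ l) (n * 2 ^ (l + 1)),
      d k * (s i * br k (x i))‖ ^ 2 ≤
      T l ^ 2 * ∑ k ∈ Finset.Ico (n * 2 ^ l) (n * 2 ^ (l + 1)), ‖d k‖ ^ 2)
    (he : ∀ l, ‖F - (firstSpan b (n * 2 ^ l)).starProjection F‖ ≤ e l)
    (hlim : ∀ i, Filter.Tendsto (fun l => ∑ k ∈ Finset.range (n * 2 ^ l),
      inner ℂ (b k) F * br k (x i)) Filter.atTop (nhds (f (x i)))) {B : ℝ}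
    (hB : ∀ L, ∑ l ∈ Finset.range L, T l * e l ≤ B) :
    ∑ i, ‖s i * (f (x i) - ∑ k ∈ Finset.range n, inner ℂ (b k) F * br k (x i))‖ ^ 2 ≤ B ^ 2 := by
  set y : ℕ → EuclideanSpace ℂ (Fin m) := fun l => WithLp.toLp 2 fun i =>
    ∑ k ∈ Finset.Ico (n * 2 ^ l) (n * 2 ^ (l + 1)), inner ℂ (b k) F * (s i * br k (x i)) with hy
  set z : EuclideanSpace ℂ (Fin m) := WithLp.toLp 2 fun i =>
    s i * (f (x i) - ∑ k ∈ Finset.range n, inner ℂ (b k) F * br k (x i)) with hz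
  have he0 : ∀ l, 0 ≤ e l := fun l => (norm_nonneg _).trans (he l)
  have hyl : ∀ l, ‖y l‖ ≤ T l * e l := by
    intro l
    refine abs_le_of_sq_le_sq' ?_ (mul_nonneg (hT l) (he0 l)) |>.2
    rw [EuclideanSpace.norm_sq_eq, mul_pow]
    refine (hblock l _).trans (mul_le_mul_of_nonneg_left ?_ (by positivity))
    refine (hb.sum_Ico_norm_inner_sq_le _ _ F).trans ?_
    exact pow_le_pow_left₀ (norm_nonneg _) (he l) 2
  have hsum : ∀ L, ‖∑ l ∈ Finset.range L, y l‖ ≤ B := fun L =>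
    (norm_sum_le _ _).trans ((Finset.sum_le_sum fun l _ => hyl l).trans (hB L))
  -- There are finitely many sample points, so coordinatewise convergence is convergence in norm and
  -- the uniform bound passes to the limit.
  have htend : Filter.Tendsto (fun L => ∑ l ∈ Finset.range L, y l) Filter.atTop (nhds z) := by
    have h0 : Filter.Tendsto (fun L => fun i => (∑ l ∈ Finset.range L, y l) i) Filter.atTop
        (nhds fun i => z i) := by
      rw [tendsto_pi_nhds]
      intro i
      have h1 := ((hlim i).sub_const
        (∑ k ∈ Finset.range n, inner ℂ (b k) F * br k (x i))).const_mul (s i)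
      refine h1.congr fun L => ?_
      rw [← sum_Ico_dyadic, add_sub_cancel_left, Finset.mul_sum]
      simp only [WithLp.ofLp_sum, Finset.sum_apply, hy]
      refine Finset.sum_congr rfl fun l _ => ?_
      rw [Finset.mul_sum]
      exact Finset.sum_congr rfl fun k _ => by ring
    exact ((PiLp.continuous_toLp 2 _).tendsto _).comp h0
  have hz : ‖z‖ ≤ B := le_of_tendsto htend.norm (.of_forall hsum)
  have h2 := pow_le_pow_left₀ (norm_nonneg z) hz 2
  rwa [EuclideanSpace.norm_sq_eq] at h2

end LeastSquaresStability

section GramForm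

variable {D : Type*} {m : ℕ}

/-- The conjugate of `c` appears because the Gram matrix is built from `vv*`, while the sampled sum
`Σ c_k v_k` is bilinear. -/
theorem quadForm_gramSum_re {ι : Type*} [Fintype ι] (v : D → ι → ℂ) (x : Fin m → D)
    (c : ι → ℂ) : (quadForm (gramSum v x) (star c)).re = ∑ i, ‖∑ k, c k * v (x i) k‖ ^ 2 := by
  have h1 : gramSum v x *ᵥ star c = ∑ i, (star (v (x i)) ⬝ᵥ star c) • v (x i) := by
    rw [gramSum, Matrix.sum_mulVec]
    exact Finset.sum_congr rfl fun i _ => rankOne_mulVec _ _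
  rw [quadForm, h1, star_star, dotProduct_sum, Complex.re_sum]
  refine Finset.sum_congr rfl fun i _ => ?_
  have h2 : star (v (x i)) ⬝ᵥ star c = star (∑ k, c k * v (x i) k) := by
    simp [dotProduct, mul_comm]
  have h3 : c ⬝ᵥ v (x i) = ∑ k, c k * v (x i) k := rfl
  rw [dotProduct_smul, h2, h3, smul_eq_mul, RCLike.star_def, Complex.conj_mul',
    ← Complex.ofReal_pow, Complex.ofReal_re]

end GramForm

/-! ### Choice of exponents and explicit constants. -/

section Numerics

theorem half_le_log_succ {n : ℕ} (hn : 1 ≤ n) : 1 / 2 ≤ Real.log ((n : ℝ) + 1) := by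
  have h1 : (2 : ℝ) ≤ n + 1 := by
    have : (1 : ℝ) ≤ n := by exact_mod_cast hn
    linarith
  have h2 := Real.log_le_log (by norm_num) h1
  have := Real.log_two_gt_d9
  linarith

theorem exp_neg_mul_log_succ (n j : ℕ) :
    Real.exp (-(j * Real.log ((n : ℝ) + 1))) = (((n : ℝ) + 1) ^ j)⁻¹ := by
  rw [Real.exp_neg, ← Real.log_pow, Real.exp_log (by positivity)]

/-- Numerical form of the upper tail bound for the block `[n 2^l, n 2^(l+1))`. -/
theorem block_tail_le {n m : ℕ} (hn : 1 ≤ n) {C q : ℝ} (hC : 0 ≤ C) (hq : 1 ≤ q)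
    (hm0 : 0 < m) (hm : C * n * Real.log ((n : ℝ) + 1) ≤ m) (l : ℕ) :
    let p := ⌈4 * Real.log ((n : ℝ) + 1) + 2 * l⌉₊
    ((n * 2 ^ l : ℕ) : ℝ) * ((m + p * (C * n * q ^ l)) / (m * (32 * (1 + l) ^ 2 * q ^ l))) ^ p ≤
      1 / (n : ℝ) ^ 2 * (1 / 2) ^ l := by
  intro p
  have hn1 : (1 : ℝ) ≤ n := by exact_mod_cast hn
  set L := Real.log ((n : ℝ) + 1) with hL
  have hL2 : 1 / 2 ≤ L := half_le_log_succ hn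
  have hm1 : (0 : ℝ) < m := by exact_mod_cast hm0
  have hl0 : (0 : ℝ) ≤ l := Nat.cast_nonneg l
  have hql : 1 ≤ q ^ l := one_le_pow₀ hq
  have hp1 : (p : ℝ) ≤ 8 * L * (1 + l) := by
    have h1 : (p : ℝ) < 4 * L + 2 * l + 1 := Nat.ceil_lt_add_one (by positivity)
    nlinarith
  have hp2 : 4 * L + 2 * l ≤ p := Nat.le_ceil _
  -- Since `p ≤ 8L(1+l)` and `CnL ≤ m`, the numerator is at most `9 m (1+l)² q^l`, and `9/32 < 1/e`.
  -- The resulting `e^{-p}` supplies `(n+1)^{-4}` and `4^{-l}`, which absorb the block size `n 2^l`.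
  have hratio : (m + p * (C * n * q ^ l)) / (m * (32 * (1 + l) ^ 2 * q ^ l)) ≤ Real.exp (-1) := by
    have h1 : p * (C * n * q ^ l) ≤ 8 * (1 + l) * q ^ l * m := by
      calc p * (C * n * q ^ l) ≤ 8 * L * (1 + l) * (C * n * q ^ l) := by gcongr
        _ = 8 * (1 + l) * q ^ l * (C * n * L) := by ring
        _ ≤ _ := by gcongr
    have h2 : (m : ℝ) + p * (C * n * q ^ l) ≤ 9 * ((1 + l) ^ 2 * q ^ l * m) := by
      have h3 : (m : ℝ) ≤ (1 + l) ^ 2 * q ^ l * m := by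
        refine le_mul_of_one_le_left hm1.le ?_
        exact one_le_mul_of_one_le_of_one_le (one_le_pow₀ (by linarith)) hql
      have h4 : (1 + (l : ℝ)) * q ^ l * m ≤ (1 + l) ^ 2 * q ^ l * m := by
        gcongr
        nlinarith
      linarith
    rw [div_le_iff₀ (by positivity)]
    refine h2.trans ?_
    have h5 : (9 : ℝ) ≤ Real.exp (-1) * 32 := by
      rw [Real.exp_neg, ← div_eq_inv_mul, le_div_iff₀ (Real.exp_pos 1)]
      have := Real.exp_one_lt_d9
      linarith
    calc 9 * ((1 + (l : ℝ)) ^ 2 * q ^ l * m) ≤ (Real.exp (-1) * 32) * ((1 + l) ^ 2 * q ^ l * m) := by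
          gcongr
      _ = _ := by ring
  have hpow : ((m + p * (C * n * q ^ l)) / (m * (32 * (1 + l) ^ 2 * q ^ l))) ^ p ≤
      (((n : ℝ) + 1) ^ 4)⁻¹ * (1 / 4) ^ l := by
    calc _ ≤ Real.exp (-1) ^ p := by gcongr
      _ = Real.exp (-p) := by rw [← Real.exp_nat_mul]; congr 1; ring
      _ ≤ Real.exp (-(((4 : ℕ) : ℝ) * L) + l * (-2)) := by
          rw [Real.exp_le_exp]; push_cast; linarith
      _ = (((n : ℝ) + 1) ^ 4)⁻¹ * Real.exp (-2) ^ l := by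
          rw [Real.exp_add, hL, exp_neg_mul_log_succ, Real.exp_nat_mul]
      _ ≤ _ := by
          gcongr
          have h1 : (2 : ℝ) ≤ Real.exp 1 := by have := Real.exp_one_gt_d9; linarith
          have h2 : Real.exp (-2) = (Real.exp 1 * Real.exp 1)⁻¹ := by
            rw [← Real.exp_add, ← Real.exp_neg]; norm_num
          rw [h2, inv_le_comm₀ (by positivity) (by norm_num)]
          nlinarith
  calc _ ≤ ((n * 2 ^ l : ℕ) : ℝ) * ((((n : ℝ) + 1) ^ 4)⁻¹ * (1 / 4) ^ l) := by gcongr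
    _ = (n * (((n : ℝ) + 1) ^ 4)⁻¹) * (1 / 2) ^ l := by
        push_cast
        have : (2 : ℝ) ^ l * (1 / 4) ^ l = (1 / 2) ^ l := by rw [← mul_pow]; norm_num
        rw [← this]; ring
    _ ≤ _ := by
        gcongr
        rw [← div_eq_mul_inv, div_le_div_iff₀ (by positivity) (by positivity), one_mul]
        calc (n : ℝ) * (n : ℝ) ^ 2 = (n : ℝ) ^ 3 := by ring
          _ ≤ ((n : ℝ) + 1) ^ 3 := by gcongr; linarith
          _ ≤ ((n : ℝ) + 1) ^ 4 := pow_le_pow_right₀ (by linarith) (by norm_num)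

/-- Numerical form of the lower tail bound for the leading block. -/
theorem leading_tail_le {n m : ℕ} (hn : 1 ≤ n) (hm : 184 * n * Real.log ((n : ℝ) + 1) ≤ m) :
    let p := ⌈21 * Real.log ((n : ℝ) + 1)⌉₊
    (n : ℝ) * (((m : ℝ) / 2 + m) / (m + m * ((1 + 2 * (n : ℝ) / m) ^ p)⁻¹)) ^ p ≤ 1 / (n : ℝ) ^ 2 := by
  intro p
  have hn1 : (1 : ℝ) ≤ n := by exact_mod_cast hn
  set L := Real.log ((n : ℝ) + 1) with hL
  have hL2 : 1 / 2 ≤ L := half_le_log_succ hn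
  have hm1 : (0 : ℝ) < m := lt_of_lt_of_le (by positivity) hm
  have hp1 : (p : ℝ) ≤ 23 * L := by
    have h1 : (p : ℝ) < 21 * L + 1 := Nat.ceil_lt_add_one (by positivity)
    linarith
  have hp2 : 21 * L ≤ p := Nat.le_ceil _
  -- The constant `184 = 8 · 23` is chosen for this bound. It gives `K^{-p} ≥ 3/4`, so the ratio
  -- below is at most `6/7 ≤ e^{-1/7}`, and `p ≥ 21L` yields `(n+1)^{-3}`.
  have hx : p * (2 * n / m : ℝ) ≤ 1 / 4 := by
    rw [mul_div_assoc', div_le_iff₀ hm1]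
    nlinarith
  have hx0 : (0 : ℝ) ≤ 2 * n / m := by positivity
  have hx2 : (2 * n / m : ℝ) ≤ 1 := by
    rw [div_le_one hm1]
    nlinarith
  have hinv : (3 : ℝ) / 4 ≤ ((1 + 2 * (n : ℝ) / m) ^ p)⁻¹ := by
    have h1 : 1 - (2 * n / m : ℝ) ≤ (1 + 2 * (n : ℝ) / m)⁻¹ := by
      rw [← one_div, le_div_iff₀ (by positivity)]
      nlinarith
    have h2 := one_add_mul_le_pow (a := -(2 * n / m : ℝ)) (by linarith) p
    calc (3 : ℝ) / 4 ≤ 1 + p * (-(2 * n / m : ℝ)) := by linarith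
      _ ≤ _ := h2
      _ ≤ ((1 + 2 * (n : ℝ) / m)⁻¹) ^ p := pow_le_pow_left₀ (by linarith) (by linarith) p
      _ = _ := inv_pow _ _
  have hratio : ((m : ℝ) / 2 + m) / (m + m * ((1 + 2 * (n : ℝ) / m) ^ p)⁻¹) ≤ Real.exp (-(1 / 7)) := by
    have h1 := Real.add_one_le_exp (-(1 / 7) : ℝ)
    refine le_trans ?_ h1
    rw [div_le_iff₀ (by positivity)]
    nlinarith
  calc _ ≤ n * Real.exp (-(1 / 7)) ^ p := by gcongr
    _ = n * Real.exp (-(p / 7)) := by rw [← Real.exp_nat_mul]; congr 2; ring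
    _ ≤ n * Real.exp (-(((3 : ℕ) : ℝ) * L)) := by
        gcongr; push_cast; linarith
    _ = n * (((n : ℝ) + 1) ^ 3)⁻¹ := by rw [hL, exp_neg_mul_log_succ]
    _ ≤ _ := by
        rw [← div_eq_mul_inv, div_le_div_iff₀ (by positivity) (by positivity), one_mul]
        calc (n : ℝ) * (n : ℝ) ^ 2 = (n : ℝ) ^ 3 := by ring
          _ ≤ ((n : ℝ) + 1) ^ 3 := by gcongr; linarith

/-- The rate at `⌈n 2^l / 4⌉` compared with the rate at `n`. -/
theorem rate_ceil_le {α β c : ℝ} (hα : 0 ≤ α) (hc : 0 ≤ c) {n : ℕ} (hn : 1 ≤ n) (l : ℕ) :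
    2 * (c * ((⌈((n * 2 ^ l : ℕ) : ℝ) / 4⌉₊ : ℝ)) ^ (-α) *
      Real.log ((⌈((n * 2 ^ l : ℕ) : ℝ) / 4⌉₊ : ℝ) + 1) ^ β) ≤
    2 * c * 4 ^ (α + |β|) * ((n : ℝ) ^ (-α) * Real.log ((n : ℝ) + 1) ^ β) *
      (((2 : ℝ) ^ (-α)) ^ l * (1 + (l : ℝ)) ^ |β|) := by
  set j := ⌈((n * 2 ^ l : ℕ) : ℝ) / 4⌉₊ with hj
  have hn1 : (1 : ℝ) ≤ n := by exact_mod_cast hn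
  set L := Real.log ((n : ℝ) + 1) with hL
  have hL2 : 1 / 2 ≤ L := half_le_log_succ hn
  have hl1 : (1 : ℝ) ≤ 1 + l := by have : (0 : ℝ) ≤ l := Nat.cast_nonneg l
                                   linarith
  have h2l : (1 : ℝ) ≤ 2 ^ l := one_le_pow₀ (by norm_num)
  have hjlow : (n : ℝ) * 2 ^ l / 4 ≤ j := by
    have := Nat.le_ceil (((n * 2 ^ l : ℕ) : ℝ) / 4)
    rw [← hj] at this
    push_cast at this
    exact this
  have hjup : (j : ℝ) ≤ n * 2 ^ l := by
    have : j ≤ n * 2 ^ l := Nat.ceil_le.2 (div_le_self (by positivity) (by norm_num))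
    exact_mod_cast this
  have hjpos : (0 : ℝ) < j := lt_of_lt_of_le (by positivity) hjlow
  have h1 : (j : ℝ) ^ (-α) ≤ 4 ^ α * (n : ℝ) ^ (-α) * ((2 : ℝ) ^ (-α)) ^ l := by
    calc (j : ℝ) ^ (-α) ≤ ((n : ℝ) * 2 ^ l / 4) ^ (-α) :=
          Real.rpow_le_rpow_of_nonpos (by positivity) hjlow (by linarith)
      _ = _ := by
          rw [Real.div_rpow (by positivity) (by norm_num), Real.mul_rpow (by positivity)
            (by positivity), Real.rpow_neg (by norm_num : (0 : ℝ) ≤ 4), div_inv_eq_mul,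
            ← Real.rpow_natCast, ← Real.rpow_natCast, ← Real.rpow_mul (by norm_num),
            ← Real.rpow_mul (by norm_num)]
          rw [mul_comm (l : ℝ)]; ring
  have hloglow : L / 4 ≤ Real.log ((j : ℝ) + 1) := by
    have h3 : ((n : ℝ) + 1) ≤ ((j : ℝ) + 1) ^ 4 := by
      have h4 : (n : ℝ) / 4 ≤ j := le_trans (by nlinarith) hjlow
      have h5 := one_add_mul_le_pow (a := (j : ℝ)) (by linarith) 4
      push_cast at h5
      rw [add_comm (j : ℝ) 1]
      linarith
    have h6 := Real.log_le_log (by positivity) h3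
    rw [Real.log_pow] at h6
    push_cast at h6
    linarith
  have hlogup : Real.log ((j : ℝ) + 1) ≤ (1 + l) * L := by
    have h3 : (j : ℝ) + 1 ≤ ((n : ℝ) + 1) ^ (1 + l) := by
      calc (j : ℝ) + 1 ≤ (n + 1) * 2 ^ l := by nlinarith
        _ ≤ (n + 1) * (n + 1) ^ l := by gcongr; linarith
        _ = _ := by rw [pow_add, pow_one]
    have h6 := Real.log_le_log (by positivity) h3
    rw [Real.log_pow] at h6
    push_cast at h6
    exact h6
  have h2 : Real.log ((j : ℝ) + 1) ^ β ≤ 4 ^ |β| * (1 + (l : ℝ)) ^ |β| * L ^ β := by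
    -- The sign of `β` decides whether the upper or the lower bound on the logarithm is the relevant
    -- one.
    rcases le_total 0 β with hβ | hβ
    · rw [abs_of_nonneg hβ]
      calc Real.log ((j : ℝ) + 1) ^ β ≤ ((1 + l) * L) ^ β :=
            Real.rpow_le_rpow (by linarith) hlogup hβ
        _ = 1 * (1 + (l : ℝ)) ^ β * L ^ β := by
            rw [Real.mul_rpow (by positivity) (by linarith), one_mul]
        _ ≤ _ := by
            gcongr
            exact Real.one_le_rpow (by norm_num) hβ
    · rw [abs_of_nonpos hβ]
      calc Real.log ((j : ℝ) + 1) ^ β ≤ (L / 4) ^ β :=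
            Real.rpow_le_rpow_of_nonpos (by linarith) hloglow hβ
        _ = 4 ^ (-β) * 1 * L ^ β := by
            rw [Real.div_rpow (by linarith) (by norm_num), Real.rpow_neg (by norm_num)]
            field_simp
        _ ≤ _ := by
            gcongr
            exact Real.one_le_rpow hl1 (by linarith)
  have hlog0 : 0 ≤ Real.log ((j : ℝ) + 1) ^ β := Real.rpow_nonneg (by linarith) _
  calc _ ≤ 2 * (c * (4 ^ α * (n : ℝ) ^ (-α) * ((2 : ℝ) ^ (-α)) ^ l) *
        (4 ^ |β| * (1 + (l : ℝ)) ^ |β| * L ^ β)) := by gcongr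
    _ = _ := by rw [Real.rpow_add (by norm_num : (0 : ℝ) < 4)]; ring

/-- Rounding the exponent up to a natural number reduces this to the shifted series of a power times
a geometric term. -/
theorem summable_rpow_mul_geometric {r : ℝ} (hr0 : 0 < r) (hr1 : r < 1) (γ : ℝ) :
    Summable fun l : ℕ => (1 + (l : ℝ)) ^ γ * r ^ l := by
  have h1 : Summable fun l : ℕ => (l : ℝ) ^ ⌈γ⌉₊ * r ^ l :=
    summable_pow_mul_geometric_of_norm_lt_one _ (by rwa [Real.norm_of_nonneg hr0.le])
  have h2 := ((summable_nat_add_iff 1).2 h1).mul_right r⁻¹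
  refine Summable.of_nonneg_of_le (fun l => by positivity) (fun l => ?_) h2
  have h3 : (1 + (l : ℝ)) ^ γ ≤ (1 + (l : ℝ)) ^ ⌈γ⌉₊ := by
    rw [← Real.rpow_natCast]
    refine Real.rpow_le_rpow_of_exponent_le ?_ (Nat.le_ceil _)
    have : (0 : ℝ) ≤ l := Nat.cast_nonneg l
    linarith
  calc _ ≤ (1 + (l : ℝ)) ^ ⌈γ⌉₊ * r ^ l := by gcongr
    _ = _ := by
      rw [pow_succ]; push_cast; field_simp; ring

end Numerics

section Blocks

variable {D : Type*} {m : ℕ} {I : Finset ℕ} {v : D → I → ℂ} {br : ℕ → D → ℂ} {s : D → ℂ}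

theorem sum_coe_mul_sample (x : Fin m → D) (h : ∀ i, ∀ k : I, v (x i) k = s (x i) * br k (x i))
    (d : ℕ → ℂ) : (quadForm (gramSum v x) (star fun k : I => d k)).re =
      ∑ i, ‖∑ k ∈ I, d k * (s (x i) * br k (x i))‖ ^ 2 := by
  rw [quadForm_gramSum_re]
  refine Finset.sum_congr rfl fun i _ => ?_
  simp only [h]
  rw [Finset.sum_coe_sort I fun k => d k * (s (x i) * br k (x i))]

theorem sum_norm_sq_star_coe (d : ℕ → ℂ) :
    ∑ k : I, ‖(star fun k : I => d k) k‖ ^ 2 = ∑ k ∈ I, ‖d k‖ ^ 2 := by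
  simp only [Pi.star_apply, norm_star]
  rw [Finset.sum_coe_sort I fun k => ‖d k‖ ^ 2]

end Blocks

/-! ### The good event for the sample points. -/

section Event

variable {D : Type*} [MeasurableSpace D] {μ : Measure D}
  {b : ℕ → Lp ℂ 2 μ} {br : ℕ → D → ℂ}

/-- With high probability the leading block of the sampled system is well conditioned from below
and all dyadic blocks are bounded from above. -/
theorem exists_good_event (hb : Orthonormal ℂ b) (hbr : ∀ k, b k =ᵐ[μ] br k) {δ : ℝ}
    (hδ : 1 / 2 < δ) {n : ℕ} (hn : 1 ≤ n) {m : ℕ}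
    (hm : 184 * n * Real.log ((n : ℝ) + 1) ≤ m)
    (hm' : 2 * 2 ^ (2 * δ) / (2 * δ - 1) * n * Real.log ((n : ℝ) + 1) ≤ m)
    {Ω : Type*} [MeasurableSpace Ω] (P : Measure Ω) [IsProbabilityMeasure P] (x : Fin m → Ω → D)
    (hlaw : ∀ i, HasLaw (x i) (μ.withDensity (samplingDensity br δ n)) P)
    (hind : iIndepFun x P) {Q : D → Prop} (hQ : ∀ᵐ y ∂μ, Q y) :
    ∃ E : Set Ω, MeasurableSet E ∧ 1 - 3 / (n : ℝ) ^ 2 ≤ P.real E ∧ ∀ ω ∈ E,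
      (∀ i, Q (x i ω)) ∧
      (∀ d : ℕ → ℂ, (m : ℝ) / 2 * ∑ k ∈ Finset.range n, ‖d k‖ ^ 2 ≤
        ∑ i, ‖∑ k ∈ Finset.range n, d k *
          (invSqrtWeight (samplingDensity br δ n) (x i ω) * br k (x i ω))‖ ^ 2) ∧
      (∀ l : ℕ, ∀ d : ℕ → ℂ, ∑ i, ‖∑ k ∈ Finset.Ico (n * 2 ^ l) (n * 2 ^ (l + 1)), d k *
          (invSqrtWeight (samplingDensity br δ n) (x i ω) * br k (x i ω))‖ ^ 2 ≤
        m * (32 * (1 + l) ^ 2 * ((2 : ℝ) ^ (2 * δ)) ^ l) *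
          ∑ k ∈ Finset.Ico (n * 2 ^ l) (n * 2 ^ (l + 1)), ‖d k‖ ^ 2) := by
  set ϱ := samplingDensity br δ n with hϱdef
  have hn1 : (1 : ℝ) ≤ n := by exact_mod_cast hn
  have hL2 := half_le_log_succ hn
  have hϱ : AEMeasurable ϱ μ := aemeasurable_samplingDensity hbr δ n
  have hϱ1 : ∫⁻ y, ϱ y ∂μ = 1 := lintegral_samplingDensity hb hbr hδ hn
  set ν := μ.withDensity ϱ with hν
  have hνp : IsProbabilityMeasure ν := ⟨by rw [hν, withDensity_apply _ .univ]; simpa using hϱ1⟩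
  have hm1 : (0 : ℝ) < m := lt_of_lt_of_le (by positivity) hm
  have hm0 : 0 < m := by exact_mod_cast hm1
  set q : ℝ := (2 : ℝ) ^ (2 * δ) with hq
  have hq1 : 1 ≤ q := Real.one_le_rpow (by norm_num) (by linarith)
  set C : ℝ := 2 * q / (2 * δ - 1) with hC
  have hC0 : 0 ≤ C := div_nonneg (by linarith) (by linarith)
  -- the isotropic vectors belonging to the blocks
  obtain ⟨v₀, hv₀, hv₀e⟩ := exists_isBoundedIsotropic hb hbr hϱ (by rw [hϱ1]; simp)
    (Finset.range n) (R := 2 * n) (by positivity)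
    (sum_range_enorm_sq_le_samplingDensity br δ hn)
  -- The powers of `n` from the normalizing constant and from the block end cancel to a single
  -- factor `n`. This is why `m` of order `n log n` suffices for all blocks.
  have hR : ∀ l : ℕ, 2 * ((n : ℝ) ^ (1 - 2 * δ) / (2 * δ - 1)) *
      ((n * 2 ^ (l + 1) : ℕ) : ℝ) ^ (2 * δ) = C * n * q ^ l := by
    intro l
    have h1 : ((n * 2 ^ (l + 1) : ℕ) : ℝ) ^ (2 * δ) = (n : ℝ) ^ (2 * δ) * (q ^ l * q) := by
      push_cast
      rw [Real.mul_rpow (by positivity) (by positivity), ← pow_succ, hq, ← Real.rpow_natCast,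
        ← Real.rpow_natCast, ← Real.rpow_mul (by norm_num), ← Real.rpow_mul (by norm_num),
        mul_comm (((l + 1 : ℕ) : ℝ))]
    have h2 : (n : ℝ) ^ (1 - 2 * δ) * (n : ℝ) ^ (2 * δ) = n := by
      rw [← Real.rpow_add (by linarith)]; simp
    rw [h1, hC]
    calc _ = ((n : ℝ) ^ (1 - 2 * δ) * (n : ℝ) ^ (2 * δ)) * (2 * q / (2 * δ - 1) * q ^ l) := by ring
      _ = _ := by rw [h2]; ring
  have hblock : ∀ l : ℕ, ∃ v : D → (Finset.Ico (n * 2 ^ l) (n * 2 ^ (l + 1))) → ℂ,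
      IsBoundedIsotropic ν v (C * n * q ^ l) ∧ ∀ᵐ y ∂ν, ∀ k, v y k = invSqrtWeight ϱ y * br k y :=
    fun l => exists_isBoundedIsotropic hb hbr hϱ (by rw [hϱ1]; simp) _ (by positivity) fun y => by
      rw [← hR]
      exact sum_Ico_enorm_sq_le_samplingDensity br hδ hn _ _
        (Nat.le_mul_of_pos_right n (by positivity)) y
  choose v hv hve using hblock
  -- almost sure properties of the sample points
  have hae : ∀ᵐ y ∂ν, Q y ∧ (∀ k, v₀ y k = invSqrtWeight ϱ y * br k y) ∧
      ∀ l, ∀ k, v l y k = invSqrtWeight ϱ y * br k y := by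
    filter_upwards [(withDensity_absolutelyContinuous μ ϱ).ae_le hQ, hv₀e, ae_all_iff.2 hve]
      with y h1 h2 h3 using ⟨h1, h2, h3⟩
  have haeΩ : ∀ᵐ ω ∂P, ∀ i, Q (x i ω) ∧
      (∀ k, v₀ (x i ω) k = invSqrtWeight ϱ (x i ω) * br k (x i ω)) ∧
      ∀ l, ∀ k, v l (x i ω) k = invSqrtWeight ϱ (x i ω) * br k (x i ω) := by
    refine ae_all_iff.2 fun i => ?_
    have h := hae
    rw [← (hlaw i).map_eq] at h
    exact ae_of_ae_map (hlaw i).aemeasurable h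
  -- the bad events
  have hXm : AEMeasurable (fun ω i => x i ω) P :=
    aemeasurable_pi_lambda _ fun i => (hlaw i).aemeasurable
  have hXlaw : P.map (fun ω i => x i ω) = Measure.pi fun _ : Fin m => ν := by
    rw [(iIndepFun_iff_map_fun_eq_pi_map fun i => (hlaw i).aemeasurable).1 hind]
    congr 1
    funext i
    exact (hlaw i).map_eq
  set B₀ : Set (Fin m → D) := {y | ∃ z : (Finset.range n) → ℂ,
    (quadForm (gramSum v₀ y) z).re < (m : ℝ) / 2 * ∑ k, ‖z k‖ ^ 2} with hB₀
  set B : ℕ → Set (Fin m → D) := fun l =>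
    {y | ∃ z : (Finset.Ico (n * 2 ^ l) (n * 2 ^ (l + 1))) → ℂ,
      m * (32 * (1 + l) ^ 2 * q ^ l) * ∑ k, ‖z k‖ ^ 2 < (quadForm (gramSum (v l) y) z).re} with hB
  have hpi : ∀ S : Set (Fin m → D), P ((fun ω i => x i ω) ⁻¹' S) ≤ Measure.pi (fun _ => ν) S :=
    fun S => by rw [← hXlaw]; exact Measure.le_map_apply hXm S
  -- The lower tail is used at level `s = m/2` with regularization `c = m`, so that `R/c = 2n/m` is
  -- of order `1/log n`.
  have hPB₀ : P ((fun ω i => x i ω) ⁻¹' B₀) ≤ ENNReal.ofReal (1 / (n : ℝ) ^ 2) := by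
    refine (hpi B₀).trans ((hv₀.measure_lower_le (by positivity) m
      ⌈21 * Real.log ((n : ℝ) + 1)⌉₊ (by positivity) hm1).trans (ENNReal.ofReal_le_ofReal ?_))
    rw [Fintype.card_coe, Finset.card_range]
    exact leading_tail_le hn hm
  have hPB : ∀ l, P ((fun ω i => x i ω) ⁻¹' B l) ≤
      ENNReal.ofReal (1 / (n : ℝ) ^ 2 * (1 / 2) ^ l) := by
    intro l
    refine (hpi (B l)).trans (((hv l).measure_upper_le (by positivity) m
      ⌈4 * Real.log ((n : ℝ) + 1) + 2 * l⌉₊ (by positivity)).trans (ENNReal.ofReal_le_ofReal ?_))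
    have hcard : (Finset.Ico (n * 2 ^ l) (n * 2 ^ (l + 1))).card = n * 2 ^ l := by
      rw [Nat.card_Ico, pow_succ, ← mul_assoc, mul_two, Nat.add_sub_cancel]
    rw [Fintype.card_coe, hcard]
    exact block_tail_le hn hC0 hq1 hm0 hm' l
  set A : Set Ω := {ω | ¬ ∀ i, Q (x i ω) ∧
      (∀ k, v₀ (x i ω) k = invSqrtWeight ϱ (x i ω) * br k (x i ω)) ∧
      ∀ l, ∀ k, v l (x i ω) k = invSqrtWeight ϱ (x i ω) * br k (x i ω)} ∪
    ((fun ω i => x i ω) ⁻¹' B₀ ∪ ⋃ l, (fun ω i => x i ω) ⁻¹' B l) with hA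
  have hPA : P A ≤ ENNReal.ofReal (3 / (n : ℝ) ^ 2) := by
    have hs : HasSum (fun l : ℕ => 1 / (n : ℝ) ^ 2 * (1 / 2) ^ l) (1 / (n : ℝ) ^ 2 * 2) :=
      hasSum_geometric_two.mul_left _
    have h1 : P (⋃ l, (fun ω i => x i ω) ⁻¹' B l) ≤ ENNReal.ofReal (1 / (n : ℝ) ^ 2 * 2) := by
      refine (measure_iUnion_le _).trans ((ENNReal.tsum_le_tsum hPB).trans ?_)
      rw [← ENNReal.ofReal_tsum_of_nonneg (fun l => by positivity) hs.summable, hs.tsum_eq]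
    calc P A ≤ 0 + (ENNReal.ofReal (1 / (n : ℝ) ^ 2) + ENNReal.ofReal (1 / (n : ℝ) ^ 2 * 2)) :=
          (measure_union_le _ _).trans (add_le_add (le_of_eq (ae_iff.1 haeΩ))
            ((measure_union_le _ _).trans (add_le_add hPB₀ h1)))
      _ = _ := by
          rw [zero_add, ← ENNReal.ofReal_add (by positivity) (by positivity)]
          congr 1
          ring
  -- The bad set has not been shown to be measurable; its measurable hull has the same probability.
  refine ⟨(toMeasurable P A)ᶜ, (measurableSet_toMeasurable P A).compl, ?_, fun ω hω => ?_⟩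
  · rw [probReal_compl_eq_one_sub (measurableSet_toMeasurable P A), measureReal_def,
      measure_toMeasurable]
    have := ENNReal.toReal_mono ENNReal.ofReal_ne_top hPA
    rw [ENNReal.toReal_ofReal (by positivity)] at this
    linarith
  · have hωA : ω ∉ A := fun h => hω (subset_toMeasurable P A h)
    simp only [hA, Set.mem_union, Set.mem_ofPred_eq, Set.mem_iUnion, Set.mem_preimage, not_or,
      not_not, not_exists] at hωA
    obtain ⟨h1, h2, h3⟩ := hωA
    refine ⟨fun i => (h1 i).1, fun d => ?_, fun l d => ?_⟩
    · have h4 := not_lt.1 fun h => h2 ⟨star fun k => d k, h⟩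
      rwa [sum_coe_mul_sample _ fun i k => (h1 i).2.1 k, sum_norm_sq_star_coe] at h4
    · have h4 := not_lt.1 fun h => h3 l ⟨star fun k => d k, h⟩
      rwa [sum_coe_mul_sample _ fun i k => (h1 i).2.2 l k, sum_norm_sq_star_coe] at h4

end Event

/-! ### Assembly of the error bound. -/

/-- Least squares error on the good event, for a single function. -/
theorem eLpNorm_sub_leastSquares_le_of_blocks {D : Type*} [MeasurableSpace D] {μ : Measure D}
    {b : ℕ → Lp ℂ 2 μ} {br : ℕ → D → ℂ} (hb : Orthonormal ℂ b) (hbr : ∀ k, b k =ᵐ[μ] br k)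
    {F : Lp ℂ 2 μ} {f : D → ℂ} (hF : F =ᵐ[μ] f) (ϱ : D → ℝ≥0∞) {m n : ℕ} (hm : 0 < m)
    (x : Fin m → D) {δ : ℝ}
    (hlow : ∀ d : ℕ → ℂ, (m : ℝ) / 2 * ∑ k ∈ Finset.range n, ‖d k‖ ^ 2 ≤
        ∑ i, ‖∑ k ∈ Finset.range n, d k * (invSqrtWeight ϱ (x i) * br k (x i))‖ ^ 2)
    (hup : ∀ l : ℕ, ∀ d : ℕ → ℂ, ∑ i, ‖∑ k ∈ Finset.Ico (n * 2 ^ l) (n * 2 ^ (l + 1)), d k *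
          (invSqrtWeight ϱ (x i) * br k (x i))‖ ^ 2 ≤
        m * (32 * (1 + l) ^ 2 * ((2 : ℝ) ^ (2 * δ)) ^ l) *
          ∑ k ∈ Finset.Ico (n * 2 ^ l) (n * 2 ^ (l + 1)), ‖d k‖ ^ 2)
    {e : ℕ → ℝ} (he : ∀ l, ‖F - (firstSpan b (n * 2 ^ l)).starProjection F‖ ≤ e l)
    (hlim : ∀ i, Filter.Tendsto (fun l => ∑ k ∈ Finset.range (n * 2 ^ l),
      inner ℂ (b k) F * br k (x i)) Filter.atTop (nhds (f (x i))))
    (hs : Summable fun l : ℕ => 8 * (1 + (l : ℝ)) * ((2 : ℝ) ^ δ) ^ l * e l) :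
    eLpNorm (f - leastSquares br ϱ n x f) 2 μ ≤
      ENNReal.ofReal (e 0 + ∑' l : ℕ, 8 * (1 + (l : ℝ)) * ((2 : ℝ) ^ δ) ^ l * e l) := by
  have he0 : ∀ l, 0 ≤ e l := fun l => (norm_nonneg _).trans (he l)
  have hm1 : (0 : ℝ) < m := by exact_mod_cast hm
  set S := ∑' l : ℕ, 8 * (1 + (l : ℝ)) * ((2 : ℝ) ^ δ) ^ l * e l with hS
  have hterm : ∀ l : ℕ, 0 ≤ 8 * (1 + (l : ℝ)) * ((2 : ℝ) ^ δ) ^ l * e l := fun l =>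
    mul_nonneg (by positivity) (he0 l)
  have hS0 : 0 ≤ S := tsum_nonneg hterm
  have h1 := eLpNorm_sub_leastSquares_le (n := n) hb hbr hF ϱ x (κ := (m : ℝ) / 2) (by positivity)
    (fun z => ?_) hS0 ?_
  · refine h1.trans (ENNReal.ofReal_le_ofReal ?_)
    have := he 0
    rw [pow_zero, mul_one] at this
    linarith
  -- Extension by zero translates between vectors indexed by `Fin n` and coefficient sequences.
  · have h2 := hlow fun k => if h : k < n then z ⟨k, h⟩ else 0
    rw [← Fin.sum_univ_eq_sum_range] at h2
    simp only [Fin.is_lt, dite_true, Fin.eta] at h2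
    refine h2.trans (le_of_eq (Finset.sum_congr rfl fun i _ => ?_))
    rw [← Fin.sum_univ_eq_sum_range (fun k => (if h : k < n then z ⟨k, h⟩ else 0) *
      (invSqrtWeight ϱ (x i) * br k (x i))) n]
    simp only [Fin.is_lt, dite_true, Fin.eta, sampleMatrix, Matrix.mulVec, dotProduct,
      Matrix.of_apply]
    congr 2
    exact Finset.sum_congr rfl fun k _ => mul_comm _ _
  · have h3 := sum_norm_sq_residual_le (n := n) hb F f (fun i => invSqrtWeight ϱ (x i)) x
      -- The block bound `32 m` equals `8² · m/2`. Pulling out the root of `m/2` cancels the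
      -- stability constant of the leading block.
      (T := fun l => Real.sqrt (m / 2) * (8 * (1 + (l : ℝ)) * ((2 : ℝ) ^ δ) ^ l)) (e := e)
      (fun l => by positivity) (fun l d => ?_) he hlim (B := Real.sqrt (m / 2) * S) fun L => ?_
    · rwa [mul_pow, Real.sq_sqrt (by positivity)] at h3
    · refine (hup l d).trans (le_of_eq ?_)
      congr 1
      rw [mul_pow, Real.sq_sqrt (by positivity), mul_pow, mul_pow, ← pow_mul, mul_comm l 2,
        pow_mul, ← Real.rpow_natCast ((2 : ℝ) ^ δ) 2, ← Real.rpow_mul (by norm_num)]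
      push_cast
      rw [mul_comm δ 2]
      ring
    · have h4 := hs.sum_le_tsum (Finset.range L) fun l _ => hterm l
      calc _ = Real.sqrt (m / 2) *
            ∑ l ∈ Finset.range L, 8 * (1 + (l : ℝ)) * ((2 : ℝ) ^ δ) ^ l * e l := by
            rw [Finset.mul_sum]; exact Finset.sum_congr rfl fun l _ => by ring
        _ ≤ _ := by gcongr

/-- The probability is stated through a measurable event `E` on which the bound holds, so no
measurability of the worst-case error is required. -/
theorem theorem3 (α β c δ : ℝ) (hα : 1 / 2 < α) (hc : 0 < c) (hδ : 1 / 2 < δ) (hδα : δ < α) :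
    ∃ C₁ C₂ : ℝ, 0 < C₁ ∧ 0 < C₂ ∧
      ∀ (D : Type*) [MeasurableSpace D] (μ : Measure D) (F₀ : Set (D → ℂ)),
        ¬ FiniteDimensional ℂ (Lp ℂ 2 μ) →
        F₀.Countable →
        (∀ f ∈ F₀, MemLp f 2 μ) →
        (∀ n : ℕ, 1 ≤ n → approxNumber (l2Classes μ F₀) n ≤
          ENNReal.ofReal (c * (n : ℝ) ^ (-α) * Real.log ((n : ℝ) + 1) ^ β)) →
        (∃ b : ℕ → Lp ℂ 2 μ, IsNearOptimalSystem (l2Classes μ F₀) b) ∧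
        ∀ (b : ℕ → Lp ℂ 2 μ) (br : ℕ → D → ℂ),
          IsNearOptimalSystem (l2Classes μ F₀) b →
          (∀ k, b k =ᵐ[μ] br k) →
          ∀ n : ℕ, 1 ≤ n →
            ∫⁻ y, samplingDensity br δ n y ∂μ = 1 ∧
            ∀ (Ω : Type*) [MeasurableSpace Ω] (P : Measure Ω) [IsProbabilityMeasure P]
              (x : Fin ⌈C₁ * (n : ℝ) * Real.log ((n : ℝ) + 1)⌉₊ → Ω → D),
              (∀ i, HasLaw (x i) (μ.withDensity (samplingDensity br δ n)) P) →
              iIndepFun x P →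
              ∃ E : Set Ω, MeasurableSet E ∧ 1 - 5 / (n : ℝ) ^ 2 ≤ P.real E ∧
                ∀ ω ∈ E,
                  worstCaseError μ F₀
                      (leastSquares br (samplingDensity br δ n) n (fun i => x i ω)) ≤
                    ENNReal.ofReal (C₂ * (n : ℝ) ^ (-α) * Real.log ((n : ℝ) + 1) ^ β) := by
  set Cδ : ℝ := 2 * 2 ^ (2 * δ) / (2 * δ - 1) with hCδ
  have hCδ0 : 0 ≤ Cδ := div_nonneg (by positivity) (by linarith)
  set g : ℕ → ℝ := fun l => ((2 : ℝ) ^ (-α)) ^ l * (1 + (l : ℝ)) ^ |β| with hg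
  have hg0 : ∀ l, 0 ≤ g l := fun l => by positivity
  have hgs : Summable fun l : ℕ => 8 * (1 + (l : ℝ)) * ((2 : ℝ) ^ δ) ^ l * g l := by
    have h := (summable_rpow_mul_geometric (r := (2 : ℝ) ^ (δ - α)) (by positivity)
      (Real.rpow_lt_one_of_one_lt_of_neg (by norm_num) (by linarith)) (|β| + 1)).mul_left 8
    refine h.congr fun l => ?_
    rw [Real.rpow_add (by positivity), Real.rpow_one, sub_eq_add_neg,
      Real.rpow_add (by norm_num), mul_pow]
    ring
  -- Square summability of the projection errors is what the almost everywhere convergence of the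
  -- dyadic partial sums requires.
  have hg2 : Summable fun l => g l ^ 2 := by
    have h := summable_rpow_mul_geometric (r := (2 : ℝ) ^ (-α) * (2 : ℝ) ^ (-α)) (by positivity)
      (mul_lt_one_of_nonneg_of_lt_one_left (by positivity)
        (Real.rpow_lt_one_of_one_lt_of_neg (by norm_num) (by linarith))
        (Real.rpow_lt_one_of_one_lt_of_neg (by norm_num) (by linarith)).le) (|β| + |β|)
    refine h.congr fun l => ?_
    rw [Real.rpow_add (by positivity), mul_pow]
    ring
  set S := ∑' l : ℕ, 8 * (1 + (l : ℝ)) * ((2 : ℝ) ^ δ) ^ l * g l with hS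
  have hS0 : 0 ≤ S := tsum_nonneg fun l => by positivity
  -- The summand `184` serves the leading block and `Cδ` the higher blocks. In `1 + S`, the `1` is
  -- the projection error and `S` the sum of the block contributions.
  refine ⟨184 + Cδ, 2 * c * 4 ^ (α + |β|) * (1 + S), by positivity, by positivity, ?_⟩
  intro D _ μ F₀ hinf hF₀c hF₀ happrox
  refine ⟨exists_isNearOptimalSystem hinf _, fun b br hopt hbr n hn =>
    ⟨lintegral_samplingDensity hopt.orthonormal hbr hδ hn, fun Ω _ P _ => ?_⟩⟩
  have hb := hopt.orthonormal
  have hn1 : (1 : ℝ) ≤ n := by exact_mod_cast hn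
  have hL := half_le_log_succ hn
  have hmle : (184 + Cδ) * (n : ℝ) * Real.log ((n : ℝ) + 1) ≤
      ⌈(184 + Cδ) * (n : ℝ) * Real.log ((n : ℝ) + 1)⌉₊ := Nat.le_ceil _
  have hm0 : 0 < ⌈(184 + Cδ) * (n : ℝ) * Real.log ((n : ℝ) + 1)⌉₊ :=
    Nat.ceil_pos.2 (by positivity)
  generalize ⌈(184 + Cδ) * (n : ℝ) * Real.log ((n : ℝ) + 1)⌉₊ = m at hmle hm0 ⊢
  intro x hlaw hind
  have hnL : 0 ≤ (n : ℝ) * Real.log ((n : ℝ) + 1) := by positivity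
  set A : ℝ := 2 * c * 4 ^ (α + |β|) * ((n : ℝ) ^ (-α) * Real.log ((n : ℝ) + 1) ^ β) with hA
  have hA0 : 0 ≤ A := by positivity
  have herr : ∀ F ∈ l2Classes μ F₀, ∀ l : ℕ,
      ‖F - (firstSpan b (n * 2 ^ l)).starProjection F‖ ≤ A * g l := by
    intro F hF l
    have hn2 : 1 ≤ n * 2 ^ l := Nat.one_le_iff_ne_zero.2 (by positivity)
    have h1 := (le_iSup₂ (f := fun F (_ : F ∈ l2Classes μ F₀) =>
      ‖F - (firstSpan b (n * 2 ^ l)).starProjection F‖ₑ) F hF).trans (hopt.proj_error _ hn2)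
    have h2 := happrox ⌈((n * 2 ^ l : ℕ) : ℝ) / 4⌉₊
      (Nat.ceil_pos.2 (by have : (0 : ℝ) < ((n * 2 ^ l : ℕ) : ℝ) := by exact_mod_cast hn2
                          positivity))
    have h3 : ‖F - (firstSpan b (n * 2 ^ l)).starProjection F‖ₑ ≤
        ENNReal.ofReal (A * g l) := by
      refine h1.trans ((mul_le_mul_right h2 2).trans ?_)
      rw [← ENNReal.ofReal_ofNat 2, ← ENNReal.ofReal_mul (by norm_num)]
      exact ENNReal.ofReal_le_ofReal (rate_ceil_le (α := α) (β := β) (by linarith) hc.le hn l)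
    rw [← ofReal_norm] at h3
    exact (ENNReal.ofReal_le_ofReal_iff (mul_nonneg hA0 (hg0 l))).1 h3
  have hclass : ∀ f (hf : f ∈ F₀), (hF₀ f hf).toLp f ∈ l2Classes μ F₀ := fun f hf =>
    ⟨f, hf, (hF₀ f hf).coeFn_toLp⟩
  -- Countability of `F₀` yields a single null set outside which all expansions converge.
  have hQ : ∀ᵐ y ∂μ, ∀ f (hf : f ∈ F₀), Filter.Tendsto (fun l =>
      ∑ k ∈ Finset.range (n * 2 ^ l), inner ℂ (b k) ((hF₀ f hf).toLp f) * br k y)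
      Filter.atTop (nhds (f y)) := by
    refine (ae_ball_iff hF₀c).2 fun f hf => ae_tendsto_partialSums hb hbr
      (hF₀ f hf).coeFn_toLp (fun l => n * 2 ^ l) ?_
    have h1 : Summable fun l => (A * g l) ^ 2 := by
      simpa only [mul_pow] using hg2.mul_left (A ^ 2)
    refine ne_top_of_le_ne_top h1.tsum_ofReal_ne_top (ENNReal.tsum_le_tsum fun l => ?_)
    rw [← ofReal_norm, ← ENNReal.ofReal_pow (norm_nonneg _)]
    exact ENNReal.ofReal_le_ofReal
      (pow_le_pow_left₀ (norm_nonneg _) (herr _ (hclass f hf) l) 2)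
  obtain ⟨E, hE, hPE, hgood⟩ := exists_good_event hb hbr hδ hn (m := m) (by nlinarith)
    (by rw [← hCδ]; nlinarith) P x hlaw hind hQ
  refine ⟨E, hE, le_trans ?_ hPE, fun ω hω => iSup₂_le fun f hf => ?_⟩
  · have : 3 / (n : ℝ) ^ 2 ≤ 5 / (n : ℝ) ^ 2 := by gcongr; norm_num
    linarith
  · obtain ⟨h1, h2, h3⟩ := hgood ω hω
    have h5 : ∀ l : ℕ, 8 * (1 + (l : ℝ)) * ((2 : ℝ) ^ δ) ^ l * (A * g l) =
        A * (8 * (1 + (l : ℝ)) * ((2 : ℝ) ^ δ) ^ l * g l) := fun l => by ring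
    have h4 := eLpNorm_sub_leastSquares_le_of_blocks hb hbr (hF₀ f hf).coeFn_toLp
      (samplingDensity br δ n) hm0 (fun i => x i ω) h2 h3 (e := fun l => A * g l)
      (herr _ (hclass f hf)) (fun i => h1 i f hf) (by simpa only [h5] using hgs.mul_left A)
    refine h4.trans (ENNReal.ofReal_le_ofReal (le_of_eq ?_))
    simp only [h5]
    rw [tsum_mul_left, ← hS]
    have : g 0 = 1 := by simp [hg]
    rw [this, hA]
    ring
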